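/- **Theorem (Median mechanism).** *Setting.* Let $X$ be a finite set with $|X|\ge 2$, let $k\ge 2$, $n\ge 1$, $0<\varepsilon\le 1/2$ and $0<\alpha\le 1$. A database is a multiset $D$ of $n$ elements of $X$; a predicate query is a function $f:X\to\{0,1\}$, and $f(D)$ is the fraction of the elements of $D$ that satisfy $f$. Two databases of size $n$ are neighbors if $|D\cap D'|=n-1$. Put $$m=\left\lceil\frac{160000\,\ln k\,\ln\frac1\varepsilon}{\varepsilon^2}\right\rceil,\qquad \alpha'=\frac{\alpha}{720\,m\ln|X|},\qquad \gamma=\frac{4}{\alpha'\varepsilon n}\ln\frac{2k}{\alpha},\qquad n_0=\frac{30\,\ln\frac{2k}{\alpha}\,\log_2 k}{\alpha'\varepsilon}.$$ The *(basic) median mechanism* with input $D$ starts with the set $C_0$ of all multisets of size $m$ over $X$. For $i=1,\dots,k$ it receives a query $f_i$, which an adversary chooses as a (measurable) function of the previous messages of the mechanism, and does the following, with fresh independent randomness: 1. it sets $r_i=\frac1{|C_{i-1}|}\sum_{S\in C_{i-1}}\exp(-\varepsilon^{-1}|f_i(D)-f_i(S)|)$ and $\hat r_i=r_i+\mathrm{Lap}\left(\frac{2}{\varepsilon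 n\alpha'}\right)$, and it draws $t_i=\frac34+j\gamma$, where $j\in\{0,1,\dots,\lfloor\frac{3}{20\gamma}\rfloor\}$ is chosen with probability proportional to $2^{-j}$; 2. if $\hat r_i\ge t_i$ (an easy query), it answers with the median $a_i$ of $f_i$ on $C_{i-1}$ and sets $C_i=C_{i-1}$; 3. if $\hat r_i<t_i$ (a hard query), it answers $a_i=f_i(D)+\mathrm{Lap}\left(\frac1{n\alpha'}\right)$ and sets $C_i=\{S\in C_{i-1}: |f_i(S)-a_i|\le\varepsilon/50\}$; 4. if there have been more than $20m\ln|X|$ hard queries so far, it reports failure and halts. Here $\mathrm{Lap}(\sigma)$ has density $\frac1{2\sigma}e^{-|x|/\sigma}$. The mechanism is $(\varepsilon,\delta)$-useful if, for every database and every adversary, with probability at least $1-\delta$ it does not fail and $|f_i(D)-a_i|\le\varepsilon$ for all $i\le k$. It is $(\alpha,\tau)$-differentially private if, for every adversary, all neighboring $D,D'$ and every measurable set $S$ of transcripts (answers and failure reports), $\Pr[M(D)\in S]\le e^\alpha\Pr[M(D')\in S]+\tau$. *Claim.* (a) *Utility.* There is an absolute constant $c>0$ such that, for all such $X,k,n,\varepsilon,\alpha$,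 the median mechanism is $(\varepsilon,\delta)$-useful with $\delta=k\exp(-c\,\varepsilon n\alpha')$. If $n\ge n_0$, this $\delta$ is inverse polynomial in $k$ and $n$: for all natural numbers $p,b$ there is a constant $B$ such that $\delta\le B/(kn)^p$ for all $k,n,\varepsilon,\alpha,X$ as above with $n\ge n_0$, $\alpha\ge k^{-b}$, $\varepsilon\ge k^{-b}$ and $\ln|X|\le k^b$. (b) *Privacy.* There is a function $\tau=\tau(k,|X|)$, not depending on $n,\varepsilon,\alpha$, which is negligible, that is, $(k|X|)^{p}\,\tau(k,|X|)\to0$ as $k,|X|\to\infty$, for every $p\in\mathbb{N}$, such that the median mechanism is $(\alpha,\tau(k,|X|))$-differentially private whenever $n\ge n_0$. (c) *Parameters.* One has $\alpha'=\Theta\left(\frac{\alpha\varepsilon^2}{\log|X|\log k\log\frac1\varepsilon}\right)$ with absolute constants, and, for every $b$, $n_0=\Theta\left(\frac{\log|X|\log^3k\log\frac1\varepsilon}{\alpha\varepsilon^3}\right)$ as long as $\alpha\ge k^{-b}$, with constants that depend only on $b$. So the privacy cost scales only with $\log k\cdot\log|X|$. -/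

import Mathlib

open MeasureTheory Filter Topology

noncomputable section

namespace MedianMechanism

/-! Databases and predicate queries -/

/-- A database of size `n` over `X`: a multiset of `n` elements of `X`. -/
abbrev Database (X : Type*) (n : ℕ) := Sym X n

/-- The value `f(D)`: the fraction of the elements of `D` that satisfy the predicate `f`. -/
def frac {X : Type*} {n : ℕ} (f : X → Bool) (D : Database X n) : ℝ :=
  ((D : Multiset X).countP (fun x => f x = true) : ℝ) / n

/-- Databases of the same size that differ in exactly one element: `|D ∩ D'| = |D| - 1`. -/
def Neighbor {X : Type*} [DecidableEq X] {n : ℕ} (D D' : Database X n) : Prop :=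
  Multiset.card ((D : Multiset X) ∩ (D' : Multiset X)) + 1 = n

/-! Interaction -/

/-- What the mechanism releases in one round: a numerical answer, and a flag that is `true`
from the round on in which failure is reported.  Rounds after the halt carry `(0, true)`. -/
abbrev Message := ℝ × Bool

/-- An adaptive analyst: the query of round `i` (counted from `0`) is a (measurable) function
of all the messages of the earlier rounds. -/
structure Analyst (X : Type*) where
  query : (i : ℕ) → (Fin i → Message) → X → Bool
  measurable_query : ∀ i x, Measurable fun h => query i h x

/-- The query which the analyst asks in round `i` of a run with transcript `y`. -/
def Analyst.queryIn {X : Type*} {k : ℕ} (A : Analyst X) (y : Fin k → Message) (i : Fin k) :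
    X → Bool :=
  A.query i fun j => y ⟨j, j.2.trans i.2⟩

/-- An interactive mechanism for `k` queries is a map `run` that sends a database, an analyst and
a source of randomness `ω` (distributed as `μ`) to a transcript.  It is `(ε, δ)`-useful if for
every database and every analyst, with probability at least `1 - δ`, it does not fail and all its
answers are `ε`-accurate for the queries asked. -/
def IsUseful {X Ω : Type*} [MeasurableSpace Ω] {n k : ℕ} (μ : Measure Ω)
    (run : Database X n → Analyst X → Ω → Fin k → Message) (ε δ : ℝ) : Prop :=
  ∀ (D : Database X n) (A : Analyst X),
    ENNReal.ofReal (1 - δ) ≤ μ {ω | ∀ i : Fin k,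
      (run D A ω i).2 = false ∧ |frac (A.queryIn (run D A ω) i) D - (run D A ω i).1| ≤ ε}

/-- `(α, τ)`-differential privacy of the transcript, for every adaptive analyst. -/
def IsDifferentiallyPrivate {X Ω : Type*} [DecidableEq X] [MeasurableSpace Ω] {n k : ℕ}
    (μ : Measure Ω) (run : Database X n → Analyst X → Ω → Fin k → Message) (α τ : ℝ) : Prop :=
  ∀ (A : Analyst X) (D D' : Database X n), Neighbor D D' →
    ∀ S : Set (Fin k → Message), MeasurableSet S →
      μ {ω | run D A ω ∈ S} ≤
        ENNReal.ofReal (Real.exp α) * μ {ω | run D' A ω ∈ S} + ENNReal.ofReal τ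

/-- Negligible functions of two parameters: `τ` tends to zero faster than every inverse
power of the product of the parameters, as both parameters tend to infinity. -/
def IsNegligible (τ : ℕ → ℕ → ℝ) : Prop :=
  ∀ c : ℕ, Tendsto (fun z : ℕ × ℕ => ((z.1 : ℝ) * z.2) ^ c * |τ z.1 z.2|) (atTop ×ˢ atTop) (𝓝 0)

/-! Parameters -/

/-- Size `N = |X|` of the domain, number `k` of queries, size `n` of the database, accuracy `ε`,
privacy `α`. -/
structure Params where
  N : ℕ
  k : ℕ
  n : ℕ
  ε : ℝ
  α : ℝ

/-- The admissible range of the parameters. -/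
structure Params.Valid (P : Params) : Prop where
  two_le_N : 2 ≤ P.N
  two_le_k : 2 ≤ P.k
  one_le_n : 1 ≤ P.n
  ε_pos : 0 < P.ε
  ε_le : P.ε ≤ 1 / 2
  α_pos : 0 < P.α
  α_le : P.α ≤ 1

namespace Params

variable (P : Params)

/-- Size of the small databases, `160000 ln k ln(1/ε) / ε²` rounded up. -/
def m : ℕ := ⌈160000 * Real.log P.k * Real.log (1 / P.ε) / P.ε ^ 2⌉₊

def α' : ℝ := P.α / (720 * P.m * Real.log P.N)

def γ : ℝ := 4 / (P.α' * P.ε * P.n) * Real.log (2 * P.k / P.α)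

/-- The largest index `j` of a threshold `3/4 + j γ`. -/
def J : ℕ := ⌊1 / P.γ * (3 / 20)⌋₊

/-- The mechanism halts when the number of hard queries exceeds this number. -/
def hardLimit : ℝ := 20 * P.m * Real.log P.N

/-- The required size of the database. -/
def n₀ : ℝ := 30 * Real.log (2 * P.k / P.α) * Real.logb 2 P.k / (P.α' * P.ε)

end Params

/-! Randomness -/

/-- The Laplace distribution `Lap(σ)`, with density `exp(-|x|/σ) / (2σ)`. -/
def laplace (σ : ℝ) : Measure ℝ :=
  volume.withDensity fun x => ENNReal.ofReal (1 / (2 * σ) * Real.exp (-|x| / σ))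

/-- The distribution on `{0, …, J}` with weights proportional to `2 ^ (-j)`. -/
def thresholdLaw (J : ℕ) : Measure ℕ :=
  ∑ j ∈ Finset.range (J + 1),
    ENNReal.ofReal ((1 / 2) ^ j / ∑ l ∈ Finset.range (J + 1), (1 / 2 : ℝ) ^ l) • Measure.dirac j

/-- Randomness of one round: perturbation of `r`, index of the threshold,
perturbation of the answer. -/
abbrev Noise := ℝ × ℕ × ℝ

def noiseLaw (P : Params) : Measure Noise :=
  (laplace (2 / (P.ε * P.n * P.α'))).prod
    ((thresholdLaw P.J).prod (laplace (1 / (P.n * P.α'))))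

/-- Independent randomness for the `k` rounds. -/
def randomness (P : Params) : Measure (Fin P.k → Noise) :=
  Measure.pi fun _ => noiseLaw P

/-! The mechanism -/

open Classical in
/-- The median of the values of `f` on a set `C` of databases: the mean of the lower and the
upper median. -/
def median {X : Type*} {m : ℕ} (C : Finset (Database X m)) (f : X → Bool) : ℝ :=
  (sInf {v : ℝ | C.card ≤ 2 * (C.filter fun S => frac f S ≤ v).card} +
    sSup {v : ℝ | C.card ≤ 2 * (C.filter fun S => v ≤ frac f S).card}) / 2

/-- The average over `S ∈ C` of `exp(-|f(D) - f(S)| / ε)`. -/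
def easiness {X : Type*} {m n : ℕ} (ε : ℝ) (C : Finset (Database X m)) (f : X → Bool)
    (D : Database X n) : ℝ :=
  (∑ S ∈ C, Real.exp (-ε⁻¹ * |frac f D - frac f S|)) / C.card

/-- State after `i` rounds: the set `C` of consistent small databases, the number of queries
classified as hard, and the messages released. -/
structure State (X : Type*) (m i : ℕ) where
  C : Finset (Database X m)
  hard : ℕ
  messages : Fin i → Message

open Classical in
/-- One round of the mechanism on database `D` with randomness `ω`. -/
def step {X : Type*} (P : Params) (D : Database X P.n) (A : Analyst X) {i : ℕ}
    (s : State X P.m i) (ω : Noise) : State X P.m (i + 1) :=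
  if P.hardLimit < s.hard then
    -- failure has been reported before
    ⟨s.C, s.hard, Fin.snoc s.messages (0, true)⟩
  else
    let f := A.query i s.messages
    if 3 / 4 + ω.2.1 * P.γ ≤ easiness P.ε s.C f D + ω.1 then
      -- an easy query
      ⟨s.C, s.hard, Fin.snoc s.messages (median s.C f, false)⟩
    else
      -- a hard query
      let a := frac f D + ω.2.2
      ⟨s.C.filter fun S => |frac f S - a| ≤ P.ε / 50, s.hard + 1,
        Fin.snoc s.messages (a, decide (P.hardLimit < ((s.hard + 1 : ℕ) : ℝ)))⟩

/-- State after `i` rounds with randomness `ω`. -/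
def stateAfter {X : Type*} [Fintype X] [DecidableEq X] (P : Params) (D : Database X P.n)
    (A : Analyst X) : (i : ℕ) → (Fin i → Noise) → State X P.m i
  | 0, _ => ⟨Finset.univ, 0, Fin.elim0⟩
  | i + 1, ω => step P D A (stateAfter P D A i (Fin.init ω)) (ω (Fin.last i))

/-- The transcript of the median mechanism. -/
def run {X : Type*} [Fintype X] [DecidableEq X] (P : Params) (D : Database X P.n)
    (A : Analyst X) (ω : Fin P.k → Noise) : Fin P.k → Message :=
  (stateAfter P D A P.k ω).messages

end MedianMechanism

end

namespace MedianMechanism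

/-! ### The Laplace distribution -/

/-! Utility. Consider the event that in every round the noise on `r` is at most 1/100 and the noise
on the answer at most `ε/100`; thresholds never exceed 9/10. On it the analysis is deterministic. An
easy query has easiness at least 37/50, so a strict majority of `C` is `ε`-close to the truth and so
is the median. A hard query has easiness at most 91/100, so filtering shrinks `C` by a factor
`exp(-1/20)`. A Chernoff bound for random samples of size `m` gives a small database that is
`ε/100`-accurate on all queries of the run, and such a database survives every filtering step. Hence
`1 ≤ |X|^m exp(-h/20)` after `h` hard queries, which keeps `h` within the limit. Adaptivity is
harmless because the invariant `State.IsAccurate` speaks of every small database that is accurate on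
the queries asked so far, not of one fixed in advance.

Privacy. Conditionally on the transcript so far, neighboring databases yield nearly the same
probability `q` of a hard query: it changes by a factor of at most `exp(α'/2)`. A hard query
therefore costs `3α'/2` (classification and answer), while an easy one costs only `4α'q`, by
`one_sub_mul_exp_le`. The number of hard queries is bounded by the halting rule. The sum `Q` of the
conditional probabilities is controlled by the supermartingale `exp(Q/2 - h)`: except with
probability `exp(-ln k ln|X|)` it stays below `2(h + ln k ln|X|)`. Both bounds are carried by a
single inequality between functions of the state, `IsPrivatelyBounded`, which is propagated
backwards from the last round by `IsPrivatelyBounded.expectStep`.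

The orders of magnitude follow from the definitions; for the inverse polynomial bound, `n ≥ n₀`
makes `εnα'` at least of order `ln² k`, which beats every power of `k`. -/

theorem integral_laplaceDensity_tail {σ t : ℝ} (hσ : 0 < σ) :
    ∫ x in Set.Ioi t, 1 / (2 * σ) * Real.exp (-x / σ) = 1 / 2 * Real.exp (-t / σ) := by
  have h := integral_exp_mul_Ioi (a := -1 / σ) (by rw [neg_div]; simpa using hσ) t
  have e : ∀ x : ℝ, -x / σ = -1 / σ * x := fun x => by ring
  rw [integral_const_mul, funext fun x => congrArg Real.exp (e x), h, e t]
  field_simp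

theorem integral_laplaceDensity {σ : ℝ} (hσ : 0 < σ) :
    ∫ x : ℝ, 1 / (2 * σ) * Real.exp (-|x| / σ) = 1 := by
  rw [integral_comp_abs (f := fun x => 1 / (2 * σ) * Real.exp (-x / σ)),
    integral_laplaceDensity_tail hσ]
  simp

theorem integrable_laplaceDensity {σ : ℝ} (hσ : 0 < σ) :
    Integrable fun x : ℝ => 1 / (2 * σ) * Real.exp (-|x| / σ) :=
  integrable_of_integral_eq_one (integral_laplaceDensity hσ)

theorem laplaceDensity_nonneg {σ : ℝ} (hσ : 0 < σ) (x : ℝ) :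
    0 ≤ 1 / (2 * σ) * Real.exp (-|x| / σ) := by positivity

theorem isProbabilityMeasure_laplace {σ : ℝ} (hσ : 0 < σ) : IsProbabilityMeasure (laplace σ) := by
  constructor
  rw [laplace, withDensity_apply _ MeasurableSet.univ, Measure.restrict_univ,
    ← ofReal_integral_eq_lintegral_ofReal (integrable_laplaceDensity hσ)
      (Eventually.of_forall (laplaceDensity_nonneg hσ)), integral_laplaceDensity hσ,
    ENNReal.ofReal_one]

theorem laplace_compl_Icc {σ t : ℝ} (hσ : 0 < σ) (ht : 0 ≤ t) :
    laplace σ (Set.Icc (-t) t)ᶜ = ENNReal.ofReal (Real.exp (-t / σ)) := by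
  have hm : MeasurableSet (Set.Icc (-t) t)ᶜ := measurableSet_Icc.compl
  rw [laplace, withDensity_apply _ hm, ← ofReal_integral_eq_lintegral_ofReal
    (integrable_laplaceDensity hσ).integrableOn
    (Eventually.of_forall (laplaceDensity_nonneg hσ))]
  congr 1
  rw [← integral_indicator hm]
  -- The integrand is a function of `|x|`, so the two tails fold into twice the right one.
  have e : ∀ x : ℝ, (Set.Icc (-t) t)ᶜ.indicator
      (fun x : ℝ => 1 / (2 * σ) * Real.exp (-|x| / σ)) x =
      (fun y => (Set.Ioi t).indicator (fun x : ℝ => 1 / (2 * σ) * Real.exp (-x / σ)) y) |x| := by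
    intro x
    beta_reduce
    by_cases hx : |x| ≤ t
    · rw [Set.indicator_of_notMem (by simpa [← abs_le] using hx),
        Set.indicator_of_notMem (by simpa using hx)]
    · rw [Set.indicator_of_mem (by simpa only [Set.mem_compl_iff, Set.mem_Icc, ← abs_le] using hx),
        Set.indicator_of_mem (by simpa using hx)]
  simp only [e]
  rw [integral_comp_abs (f := fun y =>
    (Set.Ioi t).indicator (fun x : ℝ => 1 / (2 * σ) * Real.exp (-x / σ)) y),
    integral_indicator measurableSet_Ioi, Measure.restrict_restrict measurableSet_Ioi,
    Set.inter_eq_self_of_subset_left (Set.Ioi_subset_Ioi ht), integral_laplaceDensity_tail hσ]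
  ring

theorem laplace_Icc {σ t : ℝ} (hσ : 0 < σ) (ht : 0 ≤ t) :
    laplace σ (Set.Icc (-t) t) = ENNReal.ofReal (1 - Real.exp (-t / σ)) := by
  have := isProbabilityMeasure_laplace hσ
  rw [← compl_compl (Set.Icc (-t) t), prob_compl_eq_one_sub measurableSet_Icc.compl,
    laplace_compl_Icc hσ ht, ENNReal.ofReal_sub _ (Real.exp_pos _).le, ENNReal.ofReal_one]

/-- Two translates of a Laplace distribution are within a factor `exp (d / σ)`. -/
theorem lintegral_laplace_translate_le {σ u v d : ℝ} (hσ : 0 < σ) (huv : |u - v| ≤ d)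
    {φ : ℝ → ENNReal} (hφ : Measurable φ) :
    ∫⁻ x, φ (u + x) ∂laplace σ ≤
      ENNReal.ofReal (Real.exp (d / σ)) * ∫⁻ x, φ (v + x) ∂laplace σ := by
  have hd : Measurable fun x : ℝ => ENNReal.ofReal (1 / (2 * σ) * Real.exp (-|x| / σ)) := by
    fun_prop
  have hu : Measurable fun x => φ (u + x) := by fun_prop
  have hv : Measurable fun x => φ (v + x) := by fun_prop
  -- The substitution `x ↦ x + (v - u)` moves the translation from `φ` to the density, where it can
  -- be compared pointwise.
  rw [laplace, lintegral_withDensity_eq_lintegral_mul _ hd hu,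
    lintegral_withDensity_eq_lintegral_mul _ hd hv, ← lintegral_const_mul _ (by fun_prop),
    ← lintegral_add_right_eq_self _ (v - u)]
  refine lintegral_mono fun x => ?_
  simp only [Pi.mul_apply]
  rw [show u + (x + (v - u)) = v + x by ring, ← mul_assoc, ← ENNReal.ofReal_mul (by positivity)]
  refine mul_le_mul_left (ENNReal.ofReal_le_ofReal ?_) _
  rw [mul_left_comm, ← Real.exp_add, ← add_div]
  gcongr
  have h1 : |x| ≤ |x + (v - u)| + |u - v| := by
    calc |x| = |(x + (v - u)) + (u - v)| := by congr 1; ring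
      _ ≤ _ := abs_add_le _ _
  linarith

/-! ### The distribution of the threshold -/

theorem isProbabilityMeasure_thresholdLaw (J : ℕ) : IsProbabilityMeasure (thresholdLaw J) := by
  constructor
  have hpos : (0 : ℝ) < ∑ l ∈ Finset.range (J + 1), (1 / 2 : ℝ) ^ l :=
    Finset.sum_pos (fun _ _ => by positivity) (by simp)
  simp only [thresholdLaw, Measure.coe_finsetSum, Finset.sum_apply, Measure.smul_apply,
    measure_univ, smul_eq_mul, mul_one]
  rw [← ENNReal.ofReal_sum_of_nonneg (fun _ _ => by positivity), ← Finset.sum_div,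
    div_self hpos.ne', ENNReal.ofReal_one]

theorem thresholdLaw_Iic (J : ℕ) : thresholdLaw J (Set.Iic J) = 1 := by
  have := isProbabilityMeasure_thresholdLaw J
  rw [← measure_univ (μ := thresholdLaw J)]
  simp only [thresholdLaw, Measure.coe_finsetSum, Finset.sum_apply, Measure.smul_apply,
    measure_univ]
  refine Finset.sum_congr rfl fun j hj => ?_
  have : j ≤ J := by simpa [Nat.lt_succ_iff] using hj
  simp [this]

/-! ### Positivity of the parameters -/

theorem Params.le_m (P : Params) :
    160000 * Real.log P.k * Real.log (1 / P.ε) / P.ε ^ 2 ≤ P.m := Nat.le_ceil _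

namespace Params.Valid

variable {P : Params} (hP : P.Valid)
include hP

theorem two_le_N_real : (2 : ℝ) ≤ P.N := by exact_mod_cast hP.two_le_N

theorem two_le_k_real : (2 : ℝ) ≤ P.k := by exact_mod_cast hP.two_le_k

theorem n_pos : (0 : ℝ) < P.n := by exact_mod_cast hP.one_le_n

theorem log_two_le_log_N : Real.log 2 ≤ Real.log P.N :=
  Real.log_le_log (by norm_num) hP.two_le_N_real

theorem log_two_le_log_k : Real.log 2 ≤ Real.log P.k :=
  Real.log_le_log (by norm_num) hP.two_le_k_real

theorem log_N_pos : 0 < Real.log P.N := (Real.log_pos one_lt_two).trans_le hP.log_two_le_log_N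

theorem log_k_pos : 0 < Real.log P.k := (Real.log_pos one_lt_two).trans_le hP.log_two_le_log_k

theorem log_two_le_log_inv_ε : Real.log 2 ≤ Real.log (1 / P.ε) := by
  refine Real.log_le_log (by norm_num) ?_
  rw [le_div_iff₀ hP.ε_pos]
  linarith [hP.ε_le]

theorem log_inv_ε_pos : 0 < Real.log (1 / P.ε) :=
  (Real.log_pos one_lt_two).trans_le hP.log_two_le_log_inv_ε

theorem log_k_le_m : 400000 * Real.log P.k ≤ P.m := by
  refine le_trans ?_ P.le_m
  have h2 := Real.log_two_gt_d9
  have h1 := hP.log_two_le_log_inv_ε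
  have hk := hP.log_k_pos
  have hε := hP.ε_pos
  have hε2 : P.ε ^ 2 ≤ 1 / 4 := by nlinarith [hP.ε_le]
  rw [le_div_iff₀ (by positivity)]
  calc 400000 * Real.log P.k * P.ε ^ 2 ≤ 400000 * Real.log P.k * (1 / 4) := by gcongr
    _ ≤ 160000 * Real.log P.k * Real.log (1 / P.ε) := by nlinarith

theorem m_pos : (0 : ℝ) < P.m := lt_of_lt_of_le (by linarith [hP.log_k_pos]) hP.log_k_le_m

theorem α'_pos : 0 < P.α' := by
  have := hP.m_pos; have := hP.log_N_pos; have := hP.α_pos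
  unfold Params.α'; positivity

/-- A privacy loss of `α'` on each permitted hard query uses only a small part of `α`; this leaves
room for the constants in `lossBudget`. -/
theorem α'_mul_hardLimit : P.α' * P.hardLimit = P.α / 36 := by
  have := hP.m_pos; have := hP.log_N_pos
  unfold Params.α' Params.hardLimit
  field_simp
  ring

/-- The deviation `ln k ln N` allowed in the privacy tail bound is negligible next to the number of
hard queries. -/
theorem log_mul_log_le_hardLimit : 8000000 * (Real.log P.k * Real.log P.N) ≤ P.hardLimit := by
  unfold Params.hardLimit
  nlinarith [hP.log_k_le_m, hP.log_N_pos]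

theorem one_le_hardLimit : 1 ≤ P.hardLimit := by
  refine le_trans ?_ hP.log_mul_log_le_hardLimit
  nlinarith [Real.log_two_gt_d9, hP.log_two_le_log_k, hP.log_two_le_log_N]

theorem α'_le : P.α' ≤ 1 / 36 := by
  have h := hP.α'_mul_hardLimit
  nlinarith [hP.α'_pos, hP.one_le_hardLimit, hP.α_le]

theorem γ_pos : 0 < P.γ := by
  have := hP.α'_pos; have := hP.ε_pos; have := hP.n_pos; have := hP.α_pos
  have : 0 < Real.log (2 * P.k / P.α) := by
    refine Real.log_pos ?_
    rw [lt_div_iff₀ hP.α_pos]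
    linarith [hP.α_le, hP.two_le_k_real]
  unfold Params.γ; positivity

theorem J_mul_γ_le : P.J * P.γ ≤ 3 / 20 := by
  have h := hP.γ_pos
  have : (P.J : ℝ) ≤ 1 / P.γ * (3 / 20) := Nat.floor_le (by positivity)
  calc P.J * P.γ ≤ 1 / P.γ * (3 / 20) * P.γ := by gcongr
    _ = 3 / 20 := by field_simp

theorem easinessScale_pos : 0 < 2 / (P.ε * P.n * P.α') := by
  have := hP.α'_pos; have := hP.ε_pos; have := hP.n_pos; positivity

theorem answerScale_pos : 0 < 1 / (P.n * P.α') := by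
  have := hP.α'_pos; have := hP.n_pos; positivity

theorem isProbabilityMeasure_noiseLaw : IsProbabilityMeasure (noiseLaw P) := by
  have := isProbabilityMeasure_laplace hP.easinessScale_pos
  have := isProbabilityMeasure_laplace hP.answerScale_pos
  have := isProbabilityMeasure_thresholdLaw P.J
  unfold noiseLaw
  infer_instance

end Params.Valid

/-! ### Small databases that approximate a given one -/

/-- The database with the elements `d 0, …, d (n - 1)`. -/
def databaseOf {X : Type*} {n : ℕ} (d : Fin n → X) : Database X n :=
  ⟨Multiset.map d Finset.univ.val, by simp⟩

theorem databaseOf_surjective {X : Type*} {n : ℕ} :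
    Function.Surjective (databaseOf : (Fin n → X) → Database X n) := by
  rintro ⟨s, hs⟩
  induction s using Quotient.inductionOn with
  | h l =>
    have hl : l.length = n := by simpa using hs
    subst hl
    refine ⟨l.get, Subtype.ext ?_⟩
    simp only [databaseOf, Fin.univ_val_map, List.ofFn_get]
    rfl

theorem card_database_le (X : Type*) [Fintype X] [DecidableEq X] (m : ℕ) :
    Fintype.card (Database X m) ≤ Fintype.card X ^ m := by
  simpa using Fintype.card_le_of_surjective _ (databaseOf_surjective (X := X) (n := m))

theorem frac_databaseOf {X : Type*} {n : ℕ} (d : Fin n → X) (f : X → Bool) :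
    frac f (databaseOf d) = (∑ j, if f (d j) = true then (1 : ℝ) else 0) / n := by
  simp only [frac, databaseOf, Sym.coe_mk, Multiset.countP_map, Finset.sum_boole]
  rfl

/-- Moment generating function of a centered bounded variable: `exp x ≤ 1 + x + x²` for `|x| ≤ 1`,
and the linear terms cancel. -/
theorem sum_exp_mul_le {n : ℕ} (u : Fin n → ℝ) (h0 : ∑ j, u j = 0) (h1 : ∀ j, |u j| ≤ 1) {t : ℝ}
    (ht : |t| ≤ 1) : ∑ j, Real.exp (t * u j) ≤ n * Real.exp (t ^ 2) := by
  have h : ∀ j, Real.exp (t * u j) ≤ 1 + t * u j + t ^ 2 := by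
    intro j
    have hle : |t * u j| ≤ 1 := by
      rw [abs_mul]; exact mul_le_one₀ ht (abs_nonneg _) (h1 j)
    have h2 := (abs_le.1 (Real.abs_exp_sub_one_sub_id_le hle)).2
    have h3 : (t * u j) ^ 2 ≤ t ^ 2 := by
      rw [mul_pow]
      exact mul_le_of_le_one_right (sq_nonneg _) ((sq_le_one_iff_abs_le_one _).2 (h1 j))
    linarith
  calc ∑ j, Real.exp (t * u j) ≤ ∑ j, (1 + t * u j + t ^ 2) := Finset.sum_le_sum fun j _ => h j
    _ = n * (t ^ 2 + 1) := by
      rw [Finset.sum_add_distrib, Finset.sum_add_distrib, ← Finset.mul_sum, h0]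
      simp; ring
    _ ≤ n * Real.exp (t ^ 2) := by gcongr; exact Real.add_one_le_exp _

/-- Random samples from `D` of logarithmic size approximate `D` for all queries of a family. -/
theorem exists_database_approx {X ι : Type*} [Fintype ι] [Nonempty ι] {n m : ℕ} (hn : 0 < n)
    (hm : 0 < m) (D : Database X n) (f : ι → X → Bool) {t β : ℝ} (ht : 0 < t) (ht1 : t ≤ 1)
    (h : Real.log (2 * Fintype.card ι) + m * t ^ 2 ≤ m * t * β) :
    ∃ S : Database X m, ∀ i, |frac (f i) D - frac (f i) S| ≤ β := by
  obtain ⟨d, rfl⟩ := databaseOf_surjective D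
  have hn' : (0 : ℝ) < n := by exact_mod_cast hn
  have hm' : (0 : ℝ) < m := by exact_mod_cast hm
  have : NeZero n := ⟨hn.ne'⟩
  let v : ι → Fin n → ℝ := fun i j => if f i (d j) = true then 1 else 0
  let u : ι → Fin n → ℝ := fun i j => v i j - (∑ l, v i l) / n
  have hu0 : ∀ i, ∑ j, u i j = 0 := by
    intro i
    simp only [u, Finset.sum_sub_distrib, Finset.sum_const, Finset.card_univ, Fintype.card_fin,
      nsmul_eq_mul]
    field_simp
    ring
  have hv0 : ∀ i j, 0 ≤ v i j := fun i j => by dsimp [v]; split_ifs <;> norm_num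
  have hv1 : ∀ i j, v i j ≤ 1 := fun i j => by dsimp [v]; split_ifs <;> norm_num
  have hu1 : ∀ i j, |u i j| ≤ 1 := by
    intro i j
    have h2 : 0 ≤ (∑ l, v i l) / n := div_nonneg (Finset.sum_nonneg fun l _ => hv0 i l) hn'.le
    have h3 : (∑ l, v i l) / n ≤ 1 := by
      rw [div_le_one hn']
      calc ∑ l, v i l ≤ ∑ l : Fin n, (1 : ℝ) := Finset.sum_le_sum fun l _ => hv1 i l
        _ = n := by simp
    rw [abs_le]
    constructor <;> dsimp only [u] <;> linarith [hv0 i j, hv1 i j]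
  -- Used with `r = t` and `r = -t`, for the two tails. Summing over all index tuples replaces the
  -- expectation over independent samples.
  have hs : ∀ i, ∀ r : ℝ, |r| ≤ 1 → r ^ 2 = t ^ 2 →
      ∑ s : Fin m → Fin n, ∏ l, Real.exp (r * u i (s l)) ≤ (n * Real.exp (t ^ 2)) ^ m := by
    intro i r hr hrt
    rw [← Fintype.sum_pow fun j => Real.exp (r * u i j), ← hrt]
    exact pow_le_pow_left₀ (Finset.sum_nonneg fun _ _ => (Real.exp_pos _).le)
      (sum_exp_mul_le (u i) (hu0 i) (hu1 i) hr) _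
  have hF : ∑ s : Fin m → Fin n, ∑ i,
      (∏ l, Real.exp (t * u i (s l)) + ∏ l, Real.exp (-t * u i (s l))) ≤
      ∑ s : Fin m → Fin n, 2 * Fintype.card ι * Real.exp (t ^ 2) ^ m := by
    rw [Finset.sum_comm]
    simp only [Finset.sum_add_distrib (s := (Finset.univ : Finset (Fin m → Fin n)))]
    calc _ ≤ ∑ i : ι, ((n * Real.exp (t ^ 2)) ^ m + (n * Real.exp (t ^ 2)) ^ m) := by
          refine Finset.sum_le_sum fun i _ => add_le_add (hs i t ?_ rfl) (hs i (-t) ?_ (by ring))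
          · rwa [abs_of_pos ht]
          · rwa [abs_neg, abs_of_pos ht]
      _ = _ := by
          simp [mul_pow]; ring
  -- Some sample does no worse than the average; since all the exponentials are positive, each is
  -- then bounded separately by the whole sum.
  obtain ⟨s, -, hs⟩ := Finset.exists_le_of_sum_le Finset.univ_nonempty hF
  refine ⟨databaseOf (d ∘ s), fun i => ?_⟩
  have hi : ∏ l, Real.exp (t * u i (s l)) + ∏ l, Real.exp (-t * u i (s l)) ≤
      2 * Fintype.card ι * Real.exp (t ^ 2) ^ m := by
    refine le_trans ?_ hs
    exact Finset.single_le_sum (f := fun i => ∏ l, Real.exp (t * u i (s l)) +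
      ∏ l, Real.exp (-t * u i (s l))) (fun i _ => by positivity) (Finset.mem_univ i)
  have hc : (0 : ℝ) < 2 * Fintype.card ι := by
    have : 0 < Fintype.card ι := Fintype.card_pos
    positivity
  have hR : 2 * Fintype.card ι * Real.exp (t ^ 2) ^ m =
      Real.exp (Real.log (2 * Fintype.card ι) + m * t ^ 2) := by
    rw [Real.exp_add, Real.exp_log hc, Real.exp_nat_mul]
  rw [hR, ← Real.exp_sum, ← Real.exp_sum, ← Finset.mul_sum, ← Finset.mul_sum] at hi
  have h1 : t * ∑ l, u i (s l) ≤ m * t * β :=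
    (Real.exp_le_exp.1 ((le_add_of_nonneg_right (Real.exp_pos _).le).trans hi)).trans h
  have h2 : -t * ∑ l, u i (s l) ≤ m * t * β :=
    (Real.exp_le_exp.1 ((le_add_of_nonneg_left (Real.exp_pos _).le).trans hi)).trans h
  have h1' : ∑ l, u i (s l) ≤ m * β := le_of_mul_le_mul_left (by linarith) ht
  have h2' : -∑ l, u i (s l) ≤ m * β := le_of_mul_le_mul_left (by linarith) ht
  have e : frac (f i) (databaseOf (d ∘ s)) - frac (f i) (databaseOf d) =
      (∑ l, u i (s l)) / m := by
    rw [frac_databaseOf, frac_databaseOf]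
    simp only [u, Finset.sum_sub_distrib, Finset.sum_const, Finset.card_univ, Fintype.card_fin,
      nsmul_eq_mul, v, Function.comp]
    field_simp
  rw [abs_sub_comm, e, abs_le, le_div_iff₀ hm', div_le_iff₀ hm']
  constructor <;> linarith

/-! ### The median -/

open Classical in
/-- If a majority of the values lies in an interval, then so does the median. -/
theorem median_mem_Icc {X : Type*} {m : ℕ} {C : Finset (Database X m)} {f : X → Bool} {a b : ℝ}
    (h : C.card < 2 * (C.filter fun S => a ≤ frac f S ∧ frac f S ≤ b).card) :
    median C f ∈ Set.Icc a b := by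
  set G := C.filter fun S => a ≤ frac f S ∧ frac f S ≤ b with hG
  have hGC : G ⊆ C := Finset.filter_subset _ _
  have hab : a ≤ b := by
    have : 0 < G.card := by omega
    obtain ⟨S, hS⟩ := Finset.card_pos.1 this
    rw [hG, Finset.mem_filter] at hS
    exact hS.2.1.trans hS.2.2
  -- A set disjoint from a strict majority has less than half of the elements. This excludes `v < a`
  -- as a lower median candidate and `v > b` as an upper one.
  have key : ∀ p : Database X m → Prop, (∀ S ∈ G, ¬ p S) →
      ¬ C.card ≤ 2 * (C.filter p).card := by
    intro p hp
    have hd : Disjoint (C.filter p) G := by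
      rw [Finset.disjoint_left]
      intro S hS hSG
      exact hp S hSG (Finset.mem_filter.1 hS).2
    have := Finset.card_le_card (Finset.union_subset (Finset.filter_subset p C) hGC)
    rw [Finset.card_union_of_disjoint hd] at this
    omega
  have big : ∀ p : Database X m → Prop, (∀ S ∈ G, p S) → C.card ≤ 2 * (C.filter p).card := by
    intro p hp
    have : G ⊆ C.filter p := fun S hS => Finset.mem_filter.2 ⟨hGC hS, hp S hS⟩
    have := Finset.card_le_card this
    omega
  have hbL : b ∈ {v : ℝ | C.card ≤ 2 * (C.filter fun S => frac f S ≤ v).card} :=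
    big _ fun S hS => (Finset.mem_filter.1 hS).2.2
  have haU : a ∈ {v : ℝ | C.card ≤ 2 * (C.filter fun S => v ≤ frac f S).card} :=
    big _ fun S hS => (Finset.mem_filter.1 hS).2.1
  have hL : ∀ v ∈ {v : ℝ | C.card ≤ 2 * (C.filter fun S => frac f S ≤ v).card}, a ≤ v := by
    intro v hv
    by_contra hlt
    exact key _ (fun S hS hle =>
      hlt ((Finset.mem_filter.1 hS).2.1.trans hle)) hv
  have hU : ∀ v ∈ {v : ℝ | C.card ≤ 2 * (C.filter fun S => v ≤ frac f S).card}, v ≤ b := by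
    intro v hv
    by_contra hlt
    exact key _ (fun S hS hle =>
      hlt (hle.trans (Finset.mem_filter.1 hS).2.2)) hv
  have h1 := csInf_le ⟨a, hL⟩ hbL
  have h2 := le_csInf ⟨b, hbL⟩ hL
  have h3 := le_csSup ⟨b, hU⟩ haU
  have h4 := csSup_le ⟨a, haU⟩ hU
  unfold median
  constructor <;> linarith

/-! ### Utility -/

theorem Params.Valid.exists_database_approx {P : Params} (hP : P.Valid) {X : Type*}
    (D : Database X P.n) {i : ℕ} (hi : i ≤ P.k) (f : Fin i → X → Bool) :
    ∃ S : Database X P.m, ∀ j, |frac (f j) D - frac (f j) S| ≤ P.ε / 100 := by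
  have hm : 0 < P.m := by exact_mod_cast hP.m_pos
  rcases Nat.eq_zero_or_pos i with rfl | hi0
  -- Without queries any database of size `m` will do; an element of `X` is taken from `D`.
  · obtain ⟨d, -⟩ := databaseOf_surjective D
    exact ⟨databaseOf fun _ => d ⟨0, hP.one_le_n⟩, fun j => j.elim0⟩
  have : Nonempty (Fin i) := ⟨⟨0, hi0⟩⟩
  have hε := hP.ε_pos
  -- For `β = ε/100` the choice `t = β/2` maximizes `mtβ - mt²`. The maximum `mε²/40000` is at least
  -- `4 ln k ln(1/ε)`, which exceeds `2 ln k ≥ ln(2i)`.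
  refine MedianMechanism.exists_database_approx hP.one_le_n hm D f (t := P.ε / 200)
    (by positivity) (by linarith [hP.ε_le]) ?_
  have hi0' : (0 : ℝ) < i := by exact_mod_cast hi0
  have hik : (i : ℝ) ≤ P.k := by exact_mod_cast hi
  have h1 : Real.log (2 * Fintype.card (Fin i)) ≤ 2 * Real.log P.k := by
    rw [Fintype.card_fin, Real.log_mul two_ne_zero hi0'.ne']
    linarith [hP.log_two_le_log_k, Real.log_le_log hi0' hik]
  have h2 := P.le_m
  rw [div_le_iff₀ (by positivity)] at h2
  have h3 := mul_le_mul_of_nonneg_left hP.log_two_le_log_inv_ε hP.log_k_pos.le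
  have h4 := mul_lt_mul_of_pos_left Real.log_two_gt_d9 hP.log_k_pos
  nlinarith [hP.log_k_pos]

/-- Elements farther than `ε` from the truth contribute at most `e⁻¹ ≤ 0.37` to the average and the
others at most 1. If a fraction `p` is close, then `0.74 ≤ 0.37 + 0.63 p`, which forces `p > 1/2`.
-/
theorem card_lt_two_mul_card_filter_of_le_easiness {X : Type*} {m n : ℕ} {ε : ℝ} (hε : 0 < ε)
    {C : Finset (Database X m)} (hC : C.Nonempty) {f : X → Bool} {D : Database X n}
    [DecidablePred fun S : Database X m => frac f D - ε ≤ frac f S ∧ frac f S ≤ frac f D + ε]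
    (h : 37 / 50 ≤ easiness ε C f D) :
    C.card < 2 * (C.filter fun S => frac f D - ε ≤ frac f S ∧ frac f S ≤ frac f D + ε).card := by
  have hc : (0 : ℝ) < C.card := by exact_mod_cast hC.card_pos
  rw [easiness, le_div_iff₀ hc] at h
  have he : Real.exp (-1) ≤ 37 / 100 := by
    rw [Real.exp_neg]
    have := Real.exp_one_gt_d9
    rw [inv_le_comm₀ (Real.exp_pos _) (by norm_num)]
    linarith
  have hle : ∀ S ∈ C, Real.exp (-ε⁻¹ * |frac f D - frac f S|) ≤
      37 / 100 + 63 / 100 *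
        if frac f D - ε ≤ frac f S ∧ frac f S ≤ frac f D + ε then (1 : ℝ) else 0 := by
    intro S _
    split_ifs with hS
    · norm_num
      positivity
    · rw [mul_zero, add_zero]
      refine le_trans (Real.exp_le_exp.2 ?_) he
      have : ε < |frac f D - frac f S| := by
        by_contra! hle
        rw [abs_le] at hle
        exact hS ⟨by linarith, by linarith⟩
      rw [neg_mul, neg_le_neg_iff, ← div_eq_inv_mul, one_le_div hε]
      exact this.le
  have hs := Finset.sum_le_sum hle
  rw [Finset.sum_add_distrib, ← Finset.mul_sum, Finset.sum_boole] at hs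
  simp only [Finset.sum_const, nsmul_eq_mul] at hs
  have : (C.card : ℝ) <
    2 * (C.filter fun S => frac f D - ε ≤ frac f S ∧ frac f S ≤ frac f D + ε).card := by
    linarith
  exact_mod_cast this

/-- Each survivor is within `3ε/100` of the truth and contributes at least 0.97 to an average of at
most 0.91. The surviving fraction is thus at most `0.91/0.97 < 0.95 ≤ exp(-1/20)`. -/
theorem card_filter_le_of_easiness_le {X : Type*} {m n : ℕ} {ε a : ℝ} (hε : 0 < ε)
    {C : Finset (Database X m)} {f : X → Bool} {D : Database X n}
    [DecidablePred fun S : Database X m => |frac f S - a| ≤ ε / 50]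
    (ha : |frac f D - a| ≤ ε / 100) (h : easiness ε C f D ≤ 91 / 100) :
    ((C.filter fun S => |frac f S - a| ≤ ε / 50).card : ℝ) ≤ Real.exp (-1 / 20) * C.card := by
  rcases C.eq_empty_or_nonempty with rfl | hC
  · simp
  have hc : (0 : ℝ) < C.card := by exact_mod_cast hC.card_pos
  rw [easiness, div_le_iff₀ hc] at h
  have hle : ∀ S ∈ C.filter fun S => |frac f S - a| ≤ ε / 50,
      97 / 100 ≤ Real.exp (-ε⁻¹ * |frac f D - frac f S|) := by
    intro S hS
    have h1 := (Finset.mem_filter.1 hS).2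
    have h2 : |frac f D - frac f S| ≤ ε * (3 / 100) := by
      calc _ ≤ |frac f D - a| + |a - frac f S| := abs_sub_le _ _ _
        _ ≤ _ := by rw [abs_sub_comm a]; linarith
    have h3 : ε⁻¹ * |frac f D - frac f S| ≤ 3 / 100 := by
      rwa [← div_eq_inv_mul, div_le_iff₀' hε]
    have := Real.add_one_le_exp (-ε⁻¹ * |frac f D - frac f S|)
    linarith
  have hs := Finset.card_nsmul_le_sum _ _ _ hle
  have hs2 := Finset.sum_le_sum_of_subset_of_nonneg
    (Finset.filter_subset (fun S => |frac f S - a| ≤ ε / 50) C)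
    (f := fun S => Real.exp (-ε⁻¹ * |frac f D - frac f S|)) fun _ _ _ => (Real.exp_pos _).le
  rw [nsmul_eq_mul] at hs
  have he := Real.add_one_le_exp (-1 / 20 : ℝ)
  nlinarith

theorem Analyst.queryIn_snoc_castSucc {X : Type*} {i : ℕ} (A : Analyst X) (y : Fin i → Message)
    (z : Message) (j : Fin i) :
    A.queryIn (Fin.snoc y z : Fin (i + 1) → Message) j.castSucc = A.queryIn y j := by
  unfold Analyst.queryIn
  congr 1
  funext l
  exact Fin.snoc_castSucc (α := fun _ => Message) z y ⟨l, l.2.trans j.2⟩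

theorem Analyst.queryIn_snoc_last {X : Type*} {i : ℕ} (A : Analyst X) (y : Fin i → Message)
    (z : Message) :
    A.queryIn (Fin.snoc y z : Fin (i + 1) → Message) (Fin.last i) = A.query i y := by
  unfold Analyst.queryIn
  congr 1
  funext l
  exact Fin.snoc_castSucc (α := fun _ => Message) z y l

/-- The state of a run in which no perturbation has been too large. -/
structure State.IsAccurate {X : Type*} (P : Params) (D : Database X P.n) (A : Analyst X) {i : ℕ}
    (s : State X P.m i) : Prop where
  no_failure : ∀ j, (s.messages j).2 = false
  accurate : ∀ j, |frac (A.queryIn s.messages j) D - (s.messages j).1| ≤ P.ε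
  mem_C : ∀ S, (∀ j, |frac (A.queryIn s.messages j) D - frac (A.queryIn s.messages j) S|
    ≤ P.ε / 100) → S ∈ s.C
  card_le : (s.C.card : ℝ) ≤ (P.N : ℝ) ^ P.m * Real.exp (-1 / 20) ^ s.hard

theorem le_hardLimit_of_one_le {P : Params} (hP : P.Valid) {h : ℕ}
    (H : 1 ≤ (P.N : ℝ) ^ P.m * Real.exp (-1 / 20) ^ h) : (h : ℝ) ≤ P.hardLimit := by
  have hN : (0 : ℝ) < P.N := by linarith [hP.two_le_N_real]
  have h1 := Real.log_nonneg H
  rw [Real.log_mul (by positivity) (by positivity), Real.log_pow, Real.log_pow, Real.log_exp] at h1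
  unfold Params.hardLimit
  linarith

theorem State.IsAccurate.nonempty_C {X : Type*} {P : Params} (hP : P.Valid) {D : Database X P.n}
    {A : Analyst X} {i : ℕ} {s : State X P.m i} (hs : s.IsAccurate P D A) (hi : i ≤ P.k) :
    s.C.Nonempty := by
  obtain ⟨S, hS⟩ := hP.exists_database_approx D hi (A.queryIn s.messages)
  exact ⟨S, hs.mem_C S hS⟩

/-- The noise of a round is small, and the threshold is at most `9/10`. -/
def moderateNoise (P : Params) : Set Noise :=
  Set.Icc (-(1 / 100)) (1 / 100) ×ˢ (Set.Iic P.J ×ˢ Set.Icc (-(P.ε / 100)) (P.ε / 100))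

theorem State.IsAccurate.step {X : Type*} {P : Params} (hP : P.Valid) {D : Database X P.n}
    {A : Analyst X} {i : ℕ} {s : State X P.m i} (hs : s.IsAccurate P D A) (hi : i + 1 ≤ P.k)
    {ω : Noise} (hω : ω ∈ moderateNoise P) : (step P D A s ω).IsAccurate P D A := by
  have hε := hP.ε_pos
  obtain ⟨hx, hj, hy⟩ := hω
  rw [Set.mem_Icc, ← abs_le] at hx hy
  have hC := hs.nonempty_C hP (by omega)
  have hlim : ¬ P.hardLimit < s.hard := by
    rw [not_lt]
    refine le_hardLimit_of_one_le hP (le_trans ?_ hs.card_le)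
    exact_mod_cast hC.card_pos
  unfold MedianMechanism.step
  rw [if_neg hlim]
  dsimp only
  split_ifs with heasy
  · have hr : 37 / 50 ≤ easiness P.ε s.C (A.query i s.messages) D := by
      have h1 : (0 : ℝ) ≤ ω.2.1 * P.γ := mul_nonneg (Nat.cast_nonneg _) hP.γ_pos.le
      linarith [(abs_le.1 hx).2]
    classical
    have hmed := median_mem_Icc (card_lt_two_mul_card_filter_of_le_easiness hε hC hr)
    refine ⟨fun j => ?_, fun j => ?_, fun S hS => hs.mem_C S fun j => ?_, hs.card_le⟩
    · induction j using Fin.lastCases with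
      | last => simp
      | cast j => simpa using hs.no_failure j
    · induction j using Fin.lastCases with
      | last =>
        rw [A.queryIn_snoc_last]
        dsimp only
        rw [Fin.snoc_last, abs_le]
        constructor <;> linarith [hmed.1, hmed.2]
      | cast j =>
        rw [A.queryIn_snoc_castSucc]
        dsimp only
        rw [Fin.snoc_castSucc]
        exact hs.accurate j
    · have := hS j.castSucc
      rwa [A.queryIn_snoc_castSucc] at this
  · have hr : easiness P.ε s.C (A.query i s.messages) D ≤ 91 / 100 := by
      have h1 : (ω.2.1 : ℝ) * P.γ ≤ P.J * P.γ :=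
        mul_le_mul_of_nonneg_right (by exact_mod_cast hj) hP.γ_pos.le
      linarith [(abs_le.1 hx).1, hP.J_mul_γ_le]
    have ha : |frac (A.query i s.messages) D - (frac (A.query i s.messages) D + ω.2.2)| ≤
        P.ε / 100 := by
      rwa [sub_add_cancel_left, abs_neg]
    classical
    have hcard := card_filter_le_of_easiness_le hε (C := s.C) ha hr
    set a := frac (A.query i s.messages) D + ω.2.2 with ha_def
    have hcard' : ((s.C.filter fun S => |frac (A.query i s.messages) S - a| ≤ P.ε / 50).card : ℝ) ≤
        (P.N : ℝ) ^ P.m * Real.exp (-1 / 20) ^ (s.hard + 1) := by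
      refine hcard.trans ?_
      rw [pow_succ, ← mul_assoc, mul_comm _ (Real.exp (-1 / 20))]
      exact mul_le_mul_of_nonneg_left hs.card_le (Real.exp_pos _).le
    -- The new message `z` is arbitrary because none of the queries up to this round depends on it.
    -- Survival combines an error `ε/100` of `S` with an error `ε/100` of the answer.
    have hmem : ∀ (z : Message) (S : Database X P.m),
        (∀ j, |frac (A.queryIn (Fin.snoc s.messages z : Fin (i + 1) → Message) j) D -
          frac (A.queryIn (Fin.snoc s.messages z : Fin (i + 1) → Message) j) S| ≤ P.ε / 100) →
        S ∈ s.C.filter fun S => |frac (A.query i s.messages) S - a| ≤ P.ε / 50 := by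
      intro z S hS
      rw [Finset.mem_filter]
      constructor
      · refine hs.mem_C S fun j => ?_
        have := hS j.castSucc
        rwa [A.queryIn_snoc_castSucc] at this
      · have := hS (Fin.last i)
        rw [A.queryIn_snoc_last, abs_sub_comm] at this
        calc _ ≤ _ := abs_sub_le _ (frac (A.query i s.messages) D) _
          _ ≤ _ := by linarith
    have hflag : decide (P.hardLimit < ((s.hard + 1 : ℕ) : ℝ)) = false := by
      rw [decide_eq_false_iff_not, not_lt]
      refine le_hardLimit_of_one_le hP (le_trans ?_ hcard')
      -- The witness is chosen afresh for the queries including the current one, so the filtered set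
      -- is nonempty and even the increased count respects the limit.
      obtain ⟨S, hS⟩ := hP.exists_database_approx D hi
        (A.queryIn (Fin.snoc s.messages (a, false) : Fin (i + 1) → Message))
      exact_mod_cast Finset.card_pos.2 ⟨S, hmem _ S hS⟩
    refine ⟨fun j => ?_, fun j => ?_, fun S hS => ?_, ?_⟩
    · induction j using Fin.lastCases with
      | last => simpa using hflag
      | cast j => simpa using hs.no_failure j
    · induction j using Fin.lastCases with
      | last =>
        rw [A.queryIn_snoc_last]
        dsimp only
        rw [Fin.snoc_last]
        exact ha.trans (by linarith)
      | cast j =>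
        rw [A.queryIn_snoc_castSucc]
        dsimp only
        rw [Fin.snoc_castSucc]
        exact hs.accurate j
    · convert hmem _ S hS
    · convert hcard'

theorem isAccurate_stateAfter {X : Type*} [Fintype X] [DecidableEq X] {P : Params} (hP : P.Valid)
    (hX : Fintype.card X = P.N) (D : Database X P.n) (A : Analyst X) (i : ℕ) (hi : i ≤ P.k)
    (ω : Fin i → Noise) (hω : ∀ j, ω j ∈ moderateNoise P) :
    (stateAfter P D A i ω).IsAccurate P D A := by
  induction i with
  | zero =>
    refine ⟨fun j => j.elim0, fun j => j.elim0, fun S _ => Finset.mem_univ S, ?_⟩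
    simp only [stateAfter, pow_zero, mul_one, Finset.card_univ]
    exact_mod_cast hX ▸ card_database_le X P.m
  | succ i ih =>
    exact (ih (by omega) (Fin.init ω) fun j => hω j.castSucc).step hP hi (hω _)

theorem noiseLaw_moderateNoise {P : Params} (hP : P.Valid) :
    noiseLaw P (moderateNoise P) =
      ENNReal.ofReal ((1 - Real.exp (-(P.ε * P.n * P.α') / 200)) *
        (1 - Real.exp (-(P.ε * P.n * P.α') / 100))) := by
  have := isProbabilityMeasure_laplace hP.easinessScale_pos
  have := isProbabilityMeasure_laplace hP.answerScale_pos
  have := isProbabilityMeasure_thresholdLaw P.J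
  have hε := hP.ε_pos
  have hα' := hP.α'_pos
  have hn := hP.n_pos
  have e1 : -(1 / 100) / (2 / (P.ε * P.n * P.α')) = -(P.ε * P.n * P.α') / 200 := by
    field_simp; norm_num
  have e2 : -(P.ε / 100) / (1 / (P.n * P.α')) = -(P.ε * P.n * P.α') / 100 := by
    field_simp
  rw [noiseLaw, moderateNoise, Measure.prod_prod, Measure.prod_prod, thresholdLaw_Iic, one_mul,
    laplace_Icc hP.easinessScale_pos (by norm_num), laplace_Icc hP.answerScale_pos (by positivity),
    e1, e2, ← ENNReal.ofReal_mul]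
  rw [sub_nonneg, Real.exp_le_one_iff, neg_div, neg_nonpos]
  positivity

theorem isUseful_run {P : Params} (hP : P.Valid) {X : Type*} [Fintype X] [DecidableEq X]
    (hX : Fintype.card X = P.N) :
    IsUseful (randomness P) (run (X := X) P) P.ε
      (P.k * Real.exp (-(1 / 400 * (P.ε * P.n * P.α')))) := by
  intro D A
  have := hP.isProbabilityMeasure_noiseLaw
  have hx : 0 < P.ε * P.n * P.α' := mul_pos (mul_pos hP.ε_pos hP.n_pos) hP.α'_pos
  have hk := hP.two_le_k_real
  have hsub : Set.univ.pi (fun _ : Fin P.k => moderateNoise P) ⊆ {ω | ∀ i : Fin P.k,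
      (run P D A ω i).2 = false ∧
        |frac (A.queryIn (run P D A ω) i) D - (run P D A ω i).1| ≤ P.ε} := by
    intro ω hω i
    have := isAccurate_stateAfter hP hX D A P.k le_rfl ω fun j => hω j trivial
    exact ⟨this.no_failure i, this.accurate i⟩
  refine le_trans ?_ (measure_mono hsub)
  rw [randomness, Measure.pi_pi, Finset.prod_const, Finset.card_univ, Fintype.card_fin,
    noiseLaw_moderateNoise hP]
  set x := P.ε * P.n * P.α'
  set e := Real.exp (-(1 / 400 * x)) with he
  have he0 : 0 < e := Real.exp_pos _
  have he1 : e ≤ 1 := Real.exp_le_one_iff.2 (by linarith)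
  have h1 : Real.exp (-x / 200) = e ^ 2 := by
    rw [he, ← Real.exp_nat_mul]; congr 1; push_cast; ring
  have h2 : Real.exp (-x / 100) = e ^ 4 := by
    rw [he, ← Real.exp_nat_mul]; congr 1; push_cast; ring
  rw [h1, h2, ← ENNReal.ofReal_pow (mul_nonneg (sub_nonneg.2 (pow_le_one₀ he0.le he1))
    (sub_nonneg.2 (pow_le_one₀ he0.le he1)))]
  -- If `δ ≥ 1` there is nothing to prove. Otherwise `e < 1/k ≤ 1/2`, so the failure probability of
  -- a round, `e² + e⁴ - e⁶ ≤ 2e²`, is at most `e`, and Bernoulli's inequality handles the `k`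
  -- rounds.
  rcases le_or_gt 1 (P.k * e) with hd | hd
  · rw [ENNReal.ofReal_of_nonpos (by linarith)]
    exact zero_le
  refine ENNReal.ofReal_le_ofReal ?_
  have he2 : 2 * e ≤ 1 := by nlinarith
  have hb : (1 - e ^ 2) * (1 - e ^ 4) = 1 + (-(e ^ 2 + e ^ 4 - e ^ 6)) := by ring
  have he4 : e ^ 4 ≤ e ^ 2 := pow_le_pow_of_le_one he0.le he1 (by norm_num)
  have he2' : e ^ 2 ≤ 1 := pow_le_one₀ he0.le he1
  have he6 : 0 ≤ e ^ 6 := by positivity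
  rw [hb]
  refine le_trans ?_ (one_add_mul_le_pow (by linarith) _)
  have : e ^ 2 + e ^ 4 - e ^ 6 ≤ e := by nlinarith
  nlinarith

end MedianMechanism

noncomputable section

namespace MedianMechanism

/-! ### Sensitivity -/

/-- Each of the two databases is their intersection plus one element, so both counts lie in the same
interval of length one. -/
theorem abs_frac_sub_frac_le {X : Type*} [DecidableEq X] {n : ℕ} {D D' : Database X n}
    (h : Neighbor D D') (f : X → Bool) : |frac f D - frac f D'| ≤ 1 / n := by
  have key : ∀ E : Database X n, (D : Multiset X) ∩ (D' : Multiset X) ≤ (E : Multiset X) →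
      (((D : Multiset X) ∩ (D' : Multiset X)).countP fun x => f x = true) ≤
        (E : Multiset X).countP (fun x => f x = true) ∧
      (E : Multiset X).countP (fun x => f x = true) ≤
        (((D : Multiset X) ∩ (D' : Multiset X)).countP fun x => f x = true) + 1 := by
    intro E hE
    obtain ⟨t, ht⟩ := Multiset.le_iff_exists_add.1 hE
    have hc : Multiset.card t = 1 := by
      have h1 := congrArg Multiset.card ht
      have h2 : Multiset.card (E : Multiset X) = n := E.2
      rw [Multiset.card_add, h2] at h1
      unfold Neighbor at h
      omega
    have h2 := Multiset.countP_le_card (fun x => f x = true) t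
    rw [ht, Multiset.countP_add]
    omega
  obtain ⟨h1, h2⟩ := key D (Multiset.inter_le_left ..)
  obtain ⟨h3, h4⟩ := key D' (Multiset.inter_le_right ..)
  rw [frac, frac, ← sub_div, abs_div, Nat.abs_cast]
  gcongr
  rw [abs_sub_le_iff]
  constructor
  · rw [sub_le_iff_le_add']; exact_mod_cast (by omega)
  · rw [sub_le_iff_le_add']; exact_mod_cast (by omega)

theorem exp_neg_sub_exp_neg_le {a b : ℝ} (ha : 0 ≤ a) :
    Real.exp (-a) - Real.exp (-b) ≤ |a - b| := by
  have h1 : Real.exp (-a) ≤ 1 := Real.exp_le_one_iff.2 (by linarith)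
  have h2 : Real.exp (-b) = Real.exp (-a) * Real.exp (a - b) := by
    rw [← Real.exp_add]; congr 1; ring
  have h3 := Real.add_one_le_exp (a - b)
  have h4 := Real.exp_pos (-a)
  rcases le_total b a with h | h
  · have : Real.exp (-a) ≤ Real.exp (-b) := Real.exp_le_exp.2 (by linarith)
    linarith [abs_nonneg (a - b)]
  · rw [abs_of_nonpos (by linarith)]
    nlinarith

theorem abs_exp_neg_sub_exp_neg_le {a b : ℝ} (ha : 0 ≤ a) (hb : 0 ≤ b) :
    |Real.exp (-a) - Real.exp (-b)| ≤ |a - b| :=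
  abs_sub_le_iff.2 ⟨exp_neg_sub_exp_neg_le ha, abs_sub_comm a b ▸ exp_neg_sub_exp_neg_le hb⟩

/-- Every summand is `1/ε`-Lipschitz in `f(D)`, as `exp(-x)` is 1-Lipschitz for `x ≥ 0`. The set `C`
is common to both databases because the comparison is made conditionally on the past. -/
theorem abs_easiness_sub_easiness_le {X : Type*} [DecidableEq X] {m n : ℕ} {ε : ℝ} (hε : 0 < ε)
    (C : Finset (Database X m)) (f : X → Bool) {D D' : Database X n} (h : Neighbor D D') :
    |easiness ε C f D - easiness ε C f D'| ≤ 1 / (ε * n) := by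
  rcases C.eq_empty_or_nonempty with rfl | hC
  · simp only [easiness, Finset.sum_empty, zero_div, sub_zero, abs_zero]
    positivity
  have hc : (0 : ℝ) < C.card := by exact_mod_cast hC.card_pos
  rw [easiness, easiness, ← sub_div, abs_div, Nat.abs_cast, div_le_iff₀ hc,
    ← Finset.sum_sub_distrib]
  refine (Finset.abs_sum_le_sum_abs _ _).trans ?_
  rw [mul_comm, ← nsmul_eq_mul]
  refine Finset.sum_le_card_nsmul _ _ _ fun S _ => ?_
  rw [neg_mul, neg_mul]
  refine (abs_exp_neg_sub_exp_neg_le (by positivity) (by positivity)).trans ?_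
  rw [← mul_sub, abs_mul, abs_of_pos (inv_pos.2 hε), one_div, mul_inv]
  refine mul_le_mul_of_nonneg_left ?_ (inv_pos.2 hε).le
  refine (abs_abs_sub_abs_le_abs_sub _ _).trans ?_
  rw [sub_sub_sub_cancel_right, ← one_div]
  exact abs_frac_sub_frac_le h f

section

variable {X : Type*}

/-! ### One round as an operator on functions of the state -/

/-- The state after an easy query. -/
def State.easyNext {m i : ℕ} (s : State X m i) (A : Analyst X) : State X m (i + 1) :=
  ⟨s.C, s.hard, Fin.snoc s.messages (median s.C (A.query i s.messages), false)⟩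

open Classical in
/-- The state after a hard query that is answered by `a`. -/
def hardNext (P : Params) (A : Analyst X) {i : ℕ} (s : State X P.m i) (a : ℝ) :
    State X P.m (i + 1) :=
  ⟨s.C.filter fun S => |frac (A.query i s.messages) S - a| ≤ P.ε / 50, s.hard + 1,
    Fin.snoc s.messages (a, decide (P.hardLimit < ((s.hard + 1 : ℕ) : ℝ)))⟩

theorem step_eq (P : Params) (D : Database X P.n) (A : Analyst X) {i : ℕ} (s : State X P.m i)
    (ω : Noise) : step P D A s ω =
      if P.hardLimit < s.hard then ⟨s.C, s.hard, Fin.snoc s.messages (0, true)⟩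
      else if 3 / 4 + ω.2.1 * P.γ ≤ easiness P.ε s.C (A.query i s.messages) D + ω.1 then
        s.easyNext A
      else hardNext P A s (frac (A.query i s.messages) D + ω.2.2) := rfl

/-- The expected value of `g` after one more round. -/
def expectStep (P : Params) (D : Database X P.n) (A : Analyst X) {i : ℕ}
    (g : State X P.m (i + 1) → ENNReal) (s : State X P.m i) : ENNReal :=
  ∫⁻ ω, g (step P D A s ω) ∂noiseLaw P

theorem expectStep_of_hardLimit_lt {P : Params} (hP : P.Valid) (D : Database X P.n)
    (A : Analyst X) {i : ℕ} (g : State X P.m (i + 1) → ENNReal) {s : State X P.m i}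
    (hs : P.hardLimit < s.hard) :
    expectStep P D A g s = g ⟨s.C, s.hard, Fin.snoc s.messages (0, true)⟩ := by
  have := hP.isProbabilityMeasure_noiseLaw
  simp [expectStep, step, hs]

/-! ### Measurability -/

instance State.instMeasurableSpace (X : Type*) (m i : ℕ) :
    MeasurableSpace (State X m i) :=
  letI : MeasurableSpace (Database X m) := ⊤
  .comap (fun s => (s.C, s.hard, s.messages)) inferInstance

instance Database.instMeasurableSpace (m : ℕ) : MeasurableSpace (Database X m) := ⊤

theorem State.measurable_iff {T : Type*} [MeasurableSpace T] {m i : ℕ} {F : T → State X m i} :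
    Measurable F ↔ Measurable (fun t => (F t).C) ∧ Measurable (fun t => (F t).hard) ∧
      Measurable fun t => (F t).messages := by
  refine measurable_comap_iff.trans (measurable_fun_prod.trans (and_congr Iff.rfl ?_))
  exact measurable_fun_prod

theorem State.measurable_C {m i : ℕ} : Measurable fun s : State X m i => s.C :=
  (State.measurable_iff.1 measurable_id).1

theorem State.measurable_hard {m i : ℕ} : Measurable fun s : State X m i => s.hard :=
  (State.measurable_iff.1 measurable_id).2.1

theorem State.measurable_messages {m i : ℕ} : Measurable fun s : State X m i => s.messages :=
  (State.measurable_iff.1 measurable_id).2.2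

theorem measurable_snoc {T : Type*} [MeasurableSpace T] {i : ℕ} {y : T → Fin i → Message}
    {z : T → Message} (hy : Measurable y) (hz : Measurable z) :
    Measurable fun t => (Fin.snoc (y t) (z t) : Fin (i + 1) → Message) := by
  refine measurable_pi_iff.2 fun j => ?_
  induction j using Fin.lastCases with
  | last => simpa using hz
  | cast j => simpa using measurable_pi_iff.1 hy j

theorem Analyst.measurable_query_messages (A : Analyst X) {m i : ℕ} :
    Measurable fun s : State X m i => A.query i s.messages :=
  measurable_pi_iff.2 fun x => (A.measurable_query i x).comp State.measurable_messages

variable [Fintype X]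

/-- A function of the small databases under consideration and of the query is measurable. -/
theorem State.measurable_of_C_query (A : Analyst X) {m i : ℕ}
    (F : Finset (Database X m) → (X → Bool) → ℝ) :
    Measurable fun s : State X m i => F s.C (A.query i s.messages) :=
  (Measurable.of_discrete
    (f := fun q : Finset (Database X m) × (X → Bool) => F q.1 q.2)).comp
    (State.measurable_C.prodMk A.measurable_query_messages)

theorem State.measurable_easyNext (A : Analyst X) {m i : ℕ} :
    Measurable fun s : State X m i => s.easyNext A :=
  State.measurable_iff.2 ⟨State.measurable_C, State.measurable_hard,
    measurable_snoc State.measurable_messages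
      ((State.measurable_of_C_query A median).prodMk measurable_const)⟩

theorem measurable_hardNext (P : Params) (A : Analyst X) (i : ℕ) :
    Measurable fun p : State X P.m i × ℝ => hardNext P A p.1 p.2 := by
  have hh : Measurable fun p : State X P.m i × ℝ => p.1.hard :=
    State.measurable_hard.comp measurable_fst
  refine State.measurable_iff.2 ⟨?_, hh.add_const 1,
    measurable_snoc (State.measurable_messages.comp measurable_fst) (measurable_snd.prodMk ?_)⟩
  · refine measurable_finset_iff.2 fun S => ?_
    simp only [hardNext, Finset.mem_filter]
    refine Measurable.and (measurable_finset_iff.1 (State.measurable_C.comp measurable_fst) S) ?_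
    have hS : Measurable fun p : State X P.m i × ℝ => frac (A.query i p.1.messages) S :=
      (State.measurable_of_C_query A fun _ f => frac f S).comp measurable_fst
    exact measurableSet_setOfPred.1 (measurableSet_le (hS.sub measurable_snd).abs measurable_const)
  · exact (Measurable.of_discrete
      (f := fun h : ℕ => decide (P.hardLimit < ((h + 1 : ℕ) : ℝ)))).comp hh

theorem measurable_hardNext_right (P : Params) (A : Analyst X) {i : ℕ} (s : State X P.m i) :
    Measurable fun a => hardNext P A s a := by
  have h := (measurable_hardNext P A i).comp (measurable_prodMk_left (x := s))
  exact h

theorem measurable_step (P : Params) (D : Database X P.n) (A : Analyst X) (i : ℕ) :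
    Measurable fun p : State X P.m i × Noise => step P D A p.1 p.2 := by
  have hfrac : Measurable fun p : State X P.m i × Noise => frac (A.query i p.1.messages) D :=
    (State.measurable_of_C_query A fun _ f => frac f D).comp measurable_fst
  have he : Measurable fun p : State X P.m i × Noise =>
      easiness P.ε p.1.C (A.query i p.1.messages) D :=
    (State.measurable_of_C_query A fun C f => easiness P.ε C f D).comp measurable_fst
  have hh : Measurable fun p : State X P.m i × Noise => (p.1.hard : ℝ) :=
    (Measurable.of_discrete (f := fun j : ℕ => (j : ℝ))).comp
      (State.measurable_hard.comp measurable_fst)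
  have hj : Measurable fun p : State X P.m i × Noise => (p.2.2.1 : ℝ) :=
    (Measurable.of_discrete (f := fun j : ℕ => (j : ℝ))).comp (by fun_prop)
  have ha : Measurable fun p : State X P.m i × Noise =>
      frac (A.query i p.1.messages) D + p.2.2.2 := by fun_prop
  have h1 : Measurable fun p : State X P.m i × Noise =>
      (⟨p.1.C, p.1.hard, Fin.snoc p.1.messages (0, true)⟩ : State X P.m (i + 1)) := by
    have h : Measurable fun s : State X P.m i =>
        (⟨s.C, s.hard, Fin.snoc s.messages (0, true)⟩ : State X P.m (i + 1)) :=
      State.measurable_iff.2 ⟨State.measurable_C, State.measurable_hard,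
        measurable_snoc State.measurable_messages measurable_const⟩
    exact h.comp measurable_fst
  have h2 : Measurable fun p : State X P.m i × Noise => p.1.easyNext A :=
    (State.measurable_easyNext A).comp measurable_fst
  have hp : Measurable fun p : State X P.m i × Noise =>
      (p.1, frac (A.query i p.1.messages) D + p.2.2.2) := measurable_fst.prodMk ha
  have h3 := (measurable_hardNext P A i).comp hp
  have hs1 := measurableSet_lt (measurable_const (a := P.hardLimit)) hh
  have hs2 := measurableSet_le ((hj.mul_const P.γ).const_add (3 / 4))
    (he.add (measurable_fst.comp measurable_snd))
  simp only [step_eq]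
  exact Measurable.ite hs1 h1 (Measurable.ite hs2 h2 h3)

theorem measurable_stateAfter [DecidableEq X] (P : Params) (D : Database X P.n) (A : Analyst X) (i : ℕ) :
    Measurable (stateAfter P D A i) := by
  induction i with
  | zero => exact measurable_const
  | succ i ih =>
    refine (measurable_step P D A i).comp (Measurable.prodMk (ih.comp ?_) (measurable_pi_apply _))
    exact measurable_pi_iff.2 fun j => measurable_pi_apply _

/-! ### Runs -/

theorem measurable_expectStep {P : Params} (hP : P.Valid) (D : Database X P.n) (A : Analyst X)
    {i : ℕ} {g : State X P.m (i + 1) → ENNReal} (hg : Measurable g) :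
    Measurable (expectStep P D A g) := by
  have := hP.isProbabilityMeasure_noiseLaw
  exact Measurable.lintegral_prod_right' (hg.comp (measurable_step P D A i))

/-- Fubini: the noise of the last round is independent of the state before it, so that round can be
integrated out first. -/
theorem lintegral_stateAfter_succ [DecidableEq X] {P : Params} (hP : P.Valid) (D : Database X P.n)
    (A : Analyst X) {i : ℕ} {g : State X P.m (i + 1) → ENNReal} (hg : Measurable g) :
    ∫⁻ ω, g (stateAfter P D A (i + 1) ω) ∂(Measure.pi fun _ => noiseLaw P) =
      ∫⁻ ω, expectStep P D A g (stateAfter P D A i ω) ∂(Measure.pi fun _ => noiseLaw P) := by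
  have := hP.isProbabilityMeasure_noiseLaw
  have hF : Measurable fun z : Noise × (Fin i → Noise) =>
      g (step P D A (stateAfter P D A i z.2) z.1) :=
    hg.comp ((measurable_step P D A i).comp
      (((measurable_stateAfter P D A i).comp measurable_snd).prodMk measurable_fst))
  have h := (measurePreserving_piFinSuccAbove (fun _ : Fin (i + 1) => noiseLaw P)
    (Fin.last i)).lintegral_comp hF
  rw [lintegral_prod_symm' _ hF] at h
  rw [← show _ = ∫⁻ ω, expectStep P D A g (stateAfter P D A i ω) ∂(Measure.pi fun _ => noiseLaw P)
    from h]
  refine lintegral_congr fun ω => ?_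
  have hω : (MeasurableEquiv.piFinSuccAbove (fun _ => Noise) (Fin.last i) ω).2 = Fin.init ω := by
    funext j
    simp [Fin.init, MeasurableEquiv.piFinSuccAbove]
  rw [hω]
  rfl

/-! ### The law of one round -/

/-- The probability that a query of easiness `r` is classified as easy. -/
def probEasy (P : Params) (r : ℝ) : ENNReal :=
  ∫⁻ x, thresholdLaw P.J {j : ℕ | 3 / 4 + j * P.γ ≤ r + x} ∂laplace (2 / (P.ε * P.n * P.α'))

/-- The probability that a query of easiness `r` is classified as hard. -/
def probHard (P : Params) (r : ℝ) : ENNReal :=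
  ∫⁻ x, thresholdLaw P.J {j : ℕ | ¬ 3 / 4 + j * P.γ ≤ r + x} ∂laplace (2 / (P.ε * P.n * P.α'))

theorem measurable_thresholdLaw_le (J : ℕ) (γ : ℝ) :
    Measurable fun z : ℝ => thresholdLaw J {j : ℕ | 3 / 4 + j * γ ≤ z} :=
  Monotone.measurable fun _ _ h => measure_mono fun _ hj => le_trans hj h

theorem measurable_thresholdLaw_not_le (J : ℕ) (γ : ℝ) :
    Measurable fun z : ℝ => thresholdLaw J {j : ℕ | ¬ 3 / 4 + j * γ ≤ z} :=
  Antitone.measurable fun _ _ h => measure_mono fun _ hj hj' => hj (le_trans hj' h)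

theorem probEasy_add_probHard {P : Params} (hP : P.Valid) (r : ℝ) :
    probEasy P r + probHard P r = 1 := by
  have := isProbabilityMeasure_laplace hP.easinessScale_pos
  have := isProbabilityMeasure_thresholdLaw P.J
  have hE : Measurable fun x => thresholdLaw P.J {j : ℕ | 3 / 4 + j * P.γ ≤ r + x} :=
    (measurable_thresholdLaw_le P.J P.γ).comp (measurable_const_add r)
  rw [probEasy, probHard, ← lintegral_add_left hE]
  have : ∀ x : ℝ, thresholdLaw P.J {j : ℕ | 3 / 4 + j * P.γ ≤ r + x} +
      thresholdLaw P.J {j : ℕ | ¬ 3 / 4 + j * P.γ ≤ r + x} = 1 := fun x =>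
    prob_add_prob_compl (μ := thresholdLaw P.J) (s := {j : ℕ | 3 / 4 + j * P.γ ≤ r + x})
      .of_discrete
  simp only [this, lintegral_const, measure_univ, mul_one]

/-- Sensitivity of the easiness divided by the scale of its noise: the privacy loss of one
classification. -/
theorem easinessScale_ratio {P : Params} (hP : P.Valid) :
    1 / (P.ε * P.n) / (2 / (P.ε * P.n * P.α')) = P.α' / 2 := by
  have := hP.ε_pos; have := hP.n_pos; have := hP.α'_pos
  field_simp

theorem probEasy_le {P : Params} (hP : P.Valid) {u v : ℝ} (h : |u - v| ≤ 1 / (P.ε * P.n)) :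
    probEasy P u ≤ ENNReal.ofReal (Real.exp (P.α' / 2)) * probEasy P v := by
  rw [← easinessScale_ratio hP]
  exact lintegral_laplace_translate_le hP.easinessScale_pos h (measurable_thresholdLaw_le P.J P.γ)

theorem probHard_le {P : Params} (hP : P.Valid) {u v : ℝ} (h : |u - v| ≤ 1 / (P.ε * P.n)) :
    probHard P u ≤ ENNReal.ofReal (Real.exp (P.α' / 2)) * probHard P v := by
  rw [← easinessScale_ratio hP]
  exact lintegral_laplace_translate_le hP.easinessScale_pos h
    (measurable_thresholdLaw_not_le P.J P.γ)

/-- The classification depends on the first two noise components only and the hard answer on the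
third, so by independence the hard contribution factors. -/
theorem expectStep_of_le_hardLimit {P : Params} (hP : P.Valid) (D : Database X P.n)
    (A : Analyst X) {i : ℕ} {g : State X P.m (i + 1) → ENNReal} (hg : Measurable g)
    {s : State X P.m i} (hs : ¬ P.hardLimit < s.hard) :
    expectStep P D A g s =
      probEasy P (easiness P.ε s.C (A.query i s.messages) D) * g (s.easyNext A) +
      probHard P (easiness P.ε s.C (A.query i s.messages) D) *
        ∫⁻ y, g (hardNext P A s (frac (A.query i s.messages) D + y))
          ∂laplace (1 / (P.n * P.α')) := by
  have := isProbabilityMeasure_laplace hP.easinessScale_pos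
  have := isProbabilityMeasure_laplace hP.answerScale_pos
  have := isProbabilityMeasure_thresholdLaw P.J
  have hm : Measurable fun ω => g (step P D A s ω) :=
    hg.comp ((measurable_step P D A i).comp measurable_prodMk_left)
  set r := easiness P.ε s.C (A.query i s.messages) D with hr
  set G := ∫⁻ y, g (hardNext P A s (frac (A.query i s.messages) D + y))
          ∂laplace (1 / (P.n * P.α')) with hG
  have hstep : ∀ x : ℝ, ∀ j : ℕ, ∀ y : ℝ, g (step P D A s (x, j, y)) =
      if 3 / 4 + j * P.γ ≤ r + x then g (s.easyNext A)
      else g (hardNext P A s (frac (A.query i s.messages) D + y)) := by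
    intro x j y
    rw [step_eq, if_neg hs, apply_ite g]
  rw [expectStep, noiseLaw, lintegral_prod _ hm.aemeasurable]
  have h1 : ∀ x : ℝ, ∫⁻ z, g (step P D A s (x, z))
      ∂(thresholdLaw P.J).prod (laplace (1 / (P.n * P.α'))) =
      thresholdLaw P.J {j : ℕ | 3 / 4 + j * P.γ ≤ r + x} * g (s.easyNext A) +
      thresholdLaw P.J {j : ℕ | ¬ 3 / 4 + j * P.γ ≤ r + x} * G := by
    intro x
    have hmx : Measurable fun z => g (step P D A s (x, z)) := hm.comp measurable_prodMk_left
    rw [lintegral_prod _ hmx.aemeasurable]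
    have h2 : ∀ j : ℕ, ∫⁻ y, g (step P D A s (x, j, y)) ∂laplace (1 / (P.n * P.α')) =
        {j : ℕ | 3 / 4 + j * P.γ ≤ r + x}.indicator (fun _ => g (s.easyNext A)) j +
        {j : ℕ | ¬ 3 / 4 + j * P.γ ≤ r + x}.indicator (fun _ => G) j := by
      intro j
      simp only [hstep]
      by_cases hj : 3 / 4 + j * P.γ ≤ r + x
      · simp only [hj, if_true, lintegral_const, measure_univ, mul_one]
        rw [Set.indicator_of_mem (by exact hj), Set.indicator_of_notMem (by exact fun h => h hj),
          add_zero]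
      · simp only [hj, if_false]
        rw [Set.indicator_of_notMem (by exact hj), Set.indicator_of_mem (by exact hj), zero_add]
    simp only [h2]
    rw [lintegral_add_left (Measurable.of_discrete), lintegral_indicator_const .of_discrete,
      lintegral_indicator_const .of_discrete, mul_comm, mul_comm G]
  simp only [h1]
  have hE : Measurable fun x => thresholdLaw P.J {j : ℕ | 3 / 4 + j * P.γ ≤ r + x} :=
    (measurable_thresholdLaw_le P.J P.γ).comp (measurable_const_add r)
  have hH : Measurable fun x => thresholdLaw P.J {j : ℕ | ¬ 3 / 4 + j * P.γ ≤ r + x} :=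
    (measurable_thresholdLaw_not_le P.J P.γ).comp (measurable_const_add r)
  rw [lintegral_add_left (hE.mul_const _)]
  exact congrArg₂ _ (lintegral_mul_const _ hE) (lintegral_mul_const _ hH)

end

/-! ### Privacy -/

/-- If the probability `q` of a hard query changes by a factor of at most `exp η`, and that of an
easy one too, then the probability of an easy query changes by a factor of at most
`exp (8 η q)`. -/
theorem one_sub_mul_exp_le {q q' η : ℝ} (hq0 : 0 ≤ q) (hq1 : q ≤ 1) (hη0 : 0 ≤ η)
    (hη : η ≤ 1 / 72) (h : q' ≤ Real.exp η * q) (h' : 1 - q ≤ Real.exp η * (1 - q')) :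
    (1 - q) * Real.exp (-(8 * η * q)) ≤ 1 - q' := by
  -- For `q ≥ 1/8` the bound is weaker than the factor `exp η` of `h'`. For small `q`, the ratio of
  -- the two easy probabilities is governed by the change `q' - q ≤ 2ηq` of the hard one.
  rcases le_or_gt (1 / 8) q with hq | hq
  · calc (1 - q) * Real.exp (-(8 * η * q)) ≤ (Real.exp η * (1 - q')) * Real.exp (-η) := by
          refine mul_le_mul h' (Real.exp_le_exp.2 (by nlinarith)) (Real.exp_pos _).le ?_
          exact le_trans (by linarith) h'
      _ = 1 - q' := by
          rw [mul_right_comm, ← Real.exp_add, add_neg_cancel, Real.exp_zero, one_mul]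
  · have h1 : Real.exp η ≤ 1 + 2 * η := by
      have := (abs_le.1 (Real.abs_exp_sub_one_sub_id_le (x := η)
        (by rw [abs_of_nonneg hη0]; linarith))).2
      nlinarith
    have h2 : q' ≤ q + 2 * η * q := h.trans (by nlinarith)
    have h3 := Real.add_one_le_exp (8 * η * q)
    have hηq : 0 ≤ η * q := mul_nonneg hη0 hq0
    rw [Real.exp_neg, ← div_eq_mul_inv, div_le_iff₀ (Real.exp_pos _)]
    have h4 : 0 ≤ 1 - q - 2 * (η * q) := by nlinarith
    calc 1 - q ≤ (1 - q - 2 * (η * q)) * (8 * η * q + 1) := by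
          have : 0 ≤ η * q * (6 - 8 * q - 16 * (η * q)) := mul_nonneg hηq (by nlinarith)
          nlinarith
      _ ≤ (1 - q') * Real.exp (8 * η * q) := by
          refine mul_le_mul (by linarith) h3 (by nlinarith) (by linarith)

/-- The supermartingale inequality: `Q/2 - h` grows by `q/2` in every round and drops by 1 with
probability `q`. It holds since `1 - q + q/e ≤ 1 - q/2 ≤ exp(-q/2)`. -/
theorem exp_half_mul_le_one {q : ℝ} (hq0 : 0 ≤ q) :
    Real.exp (q / 2) * (1 - q + q * Real.exp (-1)) ≤ 1 := by
  have he : Real.exp (-1) ≤ 1 / 2 := by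
    have := Real.exp_one_gt_d9
    rw [Real.exp_neg, one_div]
    exact inv_anti₀ two_pos (by linarith)
  have h1 := Real.add_one_le_exp (-(q / 2))
  calc Real.exp (q / 2) * (1 - q + q * Real.exp (-1)) ≤
      Real.exp (q / 2) * Real.exp (-(q / 2)) := by
        refine mul_le_mul_of_nonneg_left ?_ (Real.exp_pos _).le
        nlinarith
    _ = 1 := by rw [← Real.exp_add, add_neg_cancel, Real.exp_zero]

/-- The privacy loss still allowed after `h` hard queries when the conditional probabilities of
hard queries have added up to `Q`. -/
def Params.lossBudget (P : Params) (h Q : ℝ) : ℝ :=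
  3 / 2 * P.α' * (P.hardLimit + 1 - h) +
    4 * P.α' * (2 * (P.hardLimit + 1 + Real.log P.k * Real.log P.N) - Q)

/-- The exponent of a supermartingale which is at least `0` when `lossBudget` is exhausted. -/
def Params.tailExponent (P : Params) (h Q : ℝ) : ℝ :=
  Q / 2 - h - Real.log P.k * Real.log P.N

/-- With `H` the hard limit, `H + 1 ≤ 2H` and `H + 1 + ln k ln N ≤ 3H`, so the budget is at most
`3α'H + 24α'H = 27α/36`. -/
theorem Params.Valid.lossBudget_zero_le {P : Params} (hP : P.Valid) :
    P.lossBudget 0 0 ≤ P.α := by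
  have h1 := hP.α'_mul_hardLimit
  have h2 := hP.log_mul_log_le_hardLimit
  have h3 := hP.one_le_hardLimit
  have h4 := hP.α'_pos
  have h5 := hP.α_pos
  have h6 : 0 < Real.log P.k * Real.log P.N := mul_pos hP.log_k_pos hP.log_N_pos
  have h7 : P.α' * (P.hardLimit + 1 + Real.log P.k * Real.log P.N) ≤ 3 * (P.α' * P.hardLimit) := by
    nlinarith
  unfold Params.lossBudget
  nlinarith

theorem toReal_probEasy {P : Params} (hP : P.Valid) (r : ℝ) :
    probEasy P r = ENNReal.ofReal (1 - (probHard P r).toReal) ∧ (probHard P r).toReal ≤ 1 ∧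
      probHard P r = ENNReal.ofReal (probHard P r).toReal := by
  have h := probEasy_add_probHard hP r
  have h1 : probHard P r ≤ 1 := h ▸ le_add_self
  have htop : probHard P r ≠ ⊤ := ne_top_of_le_ne_top ENNReal.one_ne_top h1
  refine ⟨?_, by simpa using ENNReal.toReal_mono ENNReal.one_ne_top h1,
    (ENNReal.ofReal_toReal htop).symm⟩
  rw [ENNReal.ofReal_sub _ ENNReal.toReal_nonneg, ENNReal.ofReal_toReal htop, ENNReal.ofReal_one]
  exact ENNReal.eq_sub_of_add_eq htop h

section

variable {X : Type*}

/-- The inequality between functions of the state which is propagated backwards through the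
rounds of the mechanism. -/
def IsPrivatelyBounded (P : Params) {i : ℕ} (g g' : State X P.m i → ENNReal) : Prop :=
  ∀ (s : State X P.m i) (Q : ℝ), (s.hard : ℝ) ≤ P.hardLimit + 1 →
    g s ≤ ENNReal.ofReal (Real.exp (P.lossBudget s.hard Q)) * g' s +
      ENNReal.ofReal (Real.exp (P.tailExponent s.hard Q))

/-- Start of the backward induction. Either `Q` is moderate and the remaining budget is nonnegative,
or `Q` is so large that the tail term is at least 1 and the bound is trivial. -/
theorem isPrivatelyBounded_self {P : Params} (hP : P.Valid) {i : ℕ}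
    {g : State X P.m i → ENNReal} (hg : ∀ s, g s ≤ 1) : IsPrivatelyBounded P g g := by
  intro s Q hs
  have hα' := hP.α'_pos
  rcases le_total Q (2 * (P.hardLimit + 1 + Real.log P.k * Real.log P.N)) with hQ | hQ
  · refine le_add_right (le_mul_of_one_le_left' ?_)
    rw [ENNReal.one_le_ofReal, Real.one_le_exp_iff]
    exact add_nonneg (mul_nonneg (by positivity) (by linarith))
      (mul_nonneg (by positivity) (by linarith))
  · refine le_add_left ((hg s).trans ?_)
    rw [ENNReal.one_le_ofReal, Real.one_le_exp_iff]
    unfold Params.tailExponent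
    linarith

variable [Fintype X] [DecidableEq X]

theorem lintegral_hardNext_le {P : Params} (hP : P.Valid) {D D' : Database X P.n}
    (hD : Neighbor D D') (A : Analyst X) {i : ℕ} {g : State X P.m (i + 1) → ENNReal}
    (hg : Measurable g) (s : State X P.m i) :
    ∫⁻ y, g (hardNext P A s (frac (A.query i s.messages) D + y)) ∂laplace (1 / (P.n * P.α')) ≤
      ENNReal.ofReal (Real.exp P.α') *
        ∫⁻ y, g (hardNext P A s (frac (A.query i s.messages) D' + y))
          ∂laplace (1 / (P.n * P.α')) := by
  have hm : Measurable fun a => g (hardNext P A s a) :=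
    hg.comp (measurable_hardNext_right P A s)
  have := lintegral_laplace_translate_le hP.answerScale_pos
    (abs_frac_sub_frac_le hD (A.query i s.messages)) hm
  have e : 1 / (P.n : ℝ) / (1 / (P.n * P.α')) = P.α' := by
    have := hP.n_pos; have := hP.α'_pos
    field_simp
  rwa [e] at this

/-- `Q` is a bookkeeping variable outside the state. The hypothesis, which holds for all `Q`, is
applied at `Q + q`, where `q` is the probability under `D` that the current query is hard. The
budget then falls by exactly the loss of the branch taken, and the tail term is averaged by the
supermartingale inequality. -/
theorem IsPrivatelyBounded.expectStep {P : Params} (hP : P.Valid) {D D' : Database X P.n}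
    (hD : Neighbor D D') (A : Analyst X) {i : ℕ} {g g' : State X P.m (i + 1) → ENNReal}
    (hg : Measurable g) (hg' : Measurable g') (h : IsPrivatelyBounded P g g') :
    IsPrivatelyBounded P (expectStep P D A g) (expectStep P D' A g') := by
  intro s Q hs
  by_cases hlim : P.hardLimit < s.hard
  -- After the halt both runs append the same message, at no cost.
  · rw [expectStep_of_hardLimit_lt hP D A g hlim, expectStep_of_hardLimit_lt hP D' A g' hlim]
    exact h ⟨s.C, s.hard, Fin.snoc s.messages (0, true)⟩ Q hs
  have := isProbabilityMeasure_laplace hP.answerScale_pos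
  rw [expectStep_of_le_hardLimit hP D A hg hlim, expectStep_of_le_hardLimit hP D' A hg' hlim]
  set r := easiness P.ε s.C (A.query i s.messages) D
  set r' := easiness P.ε s.C (A.query i s.messages) D'
  have hr : |r - r'| ≤ 1 / (P.ε * P.n) := abs_easiness_sub_easiness_le hP.ε_pos _ _ hD
  have hr' : |r' - r| ≤ 1 / (P.ε * P.n) := abs_sub_comm r r' ▸ hr
  obtain ⟨hE, hq1, hH⟩ := toReal_probEasy hP r
  obtain ⟨hE', hq1', hH'⟩ := toReal_probEasy hP r'
  have h1 := probEasy_le hP hr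
  have h2 := probHard_le hP hr
  have h3 := probHard_le hP hr'
  have hq0 : 0 ≤ (probHard P r).toReal := ENNReal.toReal_nonneg
  have hq0' : 0 ≤ (probHard P r').toReal := ENNReal.toReal_nonneg
  rw [hE, hE', ← ENNReal.ofReal_mul (Real.exp_pos _).le,
    ENNReal.ofReal_le_ofReal_iff (mul_nonneg (Real.exp_pos _).le (by linarith))] at h1
  rw [hH, hH', ← ENNReal.ofReal_mul (Real.exp_pos _).le,
    ENNReal.ofReal_le_ofReal_iff (mul_nonneg (Real.exp_pos _).le hq0')] at h2
  rw [hH, hH', ← ENNReal.ofReal_mul (Real.exp_pos _).le,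
    ENNReal.ofReal_le_ofReal_iff (mul_nonneg (Real.exp_pos _).le hq0)] at h3
  rw [hH, hH', hE, hE']
  clear hE hE' hH hH'
  set q := (probHard P r).toReal
  set q' := (probHard P r').toReal
  have hα' := hP.α'_pos
  set a := P.lossBudget s.hard Q with ha
  set b := P.tailExponent s.hard Q with hb
  have ha1 : P.lossBudget s.hard (Q + q) = a - 4 * P.α' * q := by
    rw [ha]; unfold Params.lossBudget; ring
  have ha2 : P.lossBudget (s.hard + 1 : ℕ) (Q + q) = a - 4 * P.α' * q - 3 / 2 * P.α' := by
    rw [ha]; unfold Params.lossBudget; push_cast; ring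
  have hb1 : P.tailExponent s.hard (Q + q) = b + q / 2 := by
    rw [hb]; unfold Params.tailExponent; ring
  have hb2 : P.tailExponent (s.hard + 1 : ℕ) (Q + q) = b + q / 2 - 1 := by
    rw [hb]; unfold Params.tailExponent; push_cast; ring
  have heasy := h (s.easyNext A) (Q + q) hs
  rw [show (s.easyNext A).hard = s.hard from rfl, ha1, hb1] at heasy
  have hhard : ∀ z, g (hardNext P A s z) ≤
      ENNReal.ofReal (Real.exp (a - 4 * P.α' * q - 3 / 2 * P.α')) * g' (hardNext P A s z) +
        ENNReal.ofReal (Real.exp (b + q / 2 - 1)) := by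
    intro z
    have := h (hardNext P A s z) (Q + q)
      (by show ((s.hard + 1 : ℕ) : ℝ) ≤ _; push_cast; linarith)
    rwa [show (hardNext P A s z).hard = s.hard + 1 from rfl, ha2, hb2] at this
  set G' := ∫⁻ y, g' (hardNext P A s (frac (A.query i s.messages) D' + y))
    ∂laplace (1 / (P.n * P.α')) with hG'
  have hm : Measurable fun y => g' (hardNext P A s (frac (A.query i s.messages) D + y)) :=
    hg'.comp ((measurable_hardNext_right P A s).comp (measurable_const_add _))
  have hint : ∫⁻ y, g (hardNext P A s (frac (A.query i s.messages) D + y))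
      ∂laplace (1 / (P.n * P.α')) ≤
      ENNReal.ofReal (Real.exp (a - 4 * P.α' * q - 3 / 2 * P.α')) *
        (ENNReal.ofReal (Real.exp P.α') * G') + ENNReal.ofReal (Real.exp (b + q / 2 - 1)) := by
    refine (lintegral_mono fun y => hhard _).trans ?_
    rw [lintegral_add_right _ measurable_const, lintegral_const_mul _ hm, lintegral_const,
      measure_univ, mul_one]
    gcongr
    exact lintegral_hardNext_le hP hD A hg' s
  -- Easy branch: the loss `4α'q` is `8ηq` with `η = α'/2`.
  have k1 : ENNReal.ofReal (1 - q) * ENNReal.ofReal (Real.exp (a - 4 * P.α' * q)) ≤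
      ENNReal.ofReal (Real.exp a) * ENNReal.ofReal (1 - q') := by
    rw [← ENNReal.ofReal_mul (by linarith), ← ENNReal.ofReal_mul (Real.exp_pos _).le]
    refine ENNReal.ofReal_le_ofReal ?_
    rw [sub_eq_add_neg a, Real.exp_add, mul_left_comm]
    refine mul_le_mul_of_nonneg_left ?_ (Real.exp_pos _).le
    have := one_sub_mul_exp_le hq0 hq1 (by positivity) (by linarith [hP.α'_le]) h3 h1
    rwa [show 8 * (P.α' / 2) * q = 4 * P.α' * q by ring] at this
  -- Hard branch: `α'/2` for the classification and `α'` for the noisy answer exhaust `3α'/2`.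
  have k2 : ENNReal.ofReal q * (ENNReal.ofReal (Real.exp (a - 4 * P.α' * q - 3 / 2 * P.α')) *
      ENNReal.ofReal (Real.exp P.α')) ≤ ENNReal.ofReal (Real.exp a) * ENNReal.ofReal q' := by
    rw [← ENNReal.ofReal_mul (Real.exp_pos _).le, ← ENNReal.ofReal_mul hq0,
      ← ENNReal.ofReal_mul (Real.exp_pos _).le]
    refine ENNReal.ofReal_le_ofReal ?_
    rw [← Real.exp_add]
    calc _ ≤ (Real.exp (P.α' / 2) * q') * Real.exp (a - P.α' / 2) := by
          refine mul_le_mul h2 (Real.exp_le_exp.2 ?_) (Real.exp_pos _).le (by positivity)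
          have : 0 ≤ P.α' * q := by positivity
          linarith
      _ = _ := by
          rw [mul_right_comm, ← Real.exp_add]
          congr 2
          ring
  have k3 : ENNReal.ofReal (1 - q) * ENNReal.ofReal (Real.exp (b + q / 2)) +
      ENNReal.ofReal q * ENNReal.ofReal (Real.exp (b + q / 2 - 1)) ≤
      ENNReal.ofReal (Real.exp b) := by
    rw [← ENNReal.ofReal_mul (by linarith), ← ENNReal.ofReal_mul hq0,
      ← ENNReal.ofReal_add (mul_nonneg (by linarith) (Real.exp_pos _).le) (by positivity)]
    refine ENNReal.ofReal_le_ofReal ?_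
    have := mul_le_mul_of_nonneg_left (exp_half_mul_le_one hq0) (Real.exp_pos b).le
    rw [sub_eq_add_neg (b + q / 2), Real.exp_add (b + q / 2), Real.exp_add b]
    linarith
  calc _ ≤ ENNReal.ofReal (1 - q) * (ENNReal.ofReal (Real.exp (a - 4 * P.α' * q)) *
          g' (s.easyNext A) + ENNReal.ofReal (Real.exp (b + q / 2))) +
        ENNReal.ofReal q * (ENNReal.ofReal (Real.exp (a - 4 * P.α' * q - 3 / 2 * P.α')) *
        (ENNReal.ofReal (Real.exp P.α') * G') + ENNReal.ofReal (Real.exp (b + q / 2 - 1))) := by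
        gcongr
    _ = ENNReal.ofReal (1 - q) * ENNReal.ofReal (Real.exp (a - 4 * P.α' * q)) *
          g' (s.easyNext A) +
        ENNReal.ofReal q * (ENNReal.ofReal (Real.exp (a - 4 * P.α' * q - 3 / 2 * P.α')) *
          ENNReal.ofReal (Real.exp P.α')) * G' +
        (ENNReal.ofReal (1 - q) * ENNReal.ofReal (Real.exp (b + q / 2)) +
          ENNReal.ofReal q * ENNReal.ofReal (Real.exp (b + q / 2 - 1))) := by ring
    _ ≤ ENNReal.ofReal (Real.exp a) * ENNReal.ofReal (1 - q') * g' (s.easyNext A) +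
        ENNReal.ofReal (Real.exp a) * ENNReal.ofReal q' * G' + ENNReal.ofReal (Real.exp b) := by
        gcongr
    _ = _ := by ring

theorem IsPrivatelyBounded.lintegral_stateAfter_le {P : Params} (hP : P.Valid)
    {D D' : Database X P.n} (hD : Neighbor D D') (A : Analyst X) {i : ℕ}
    {g g' : State X P.m i → ENNReal} (hg : Measurable g) (hg' : Measurable g')
    (h : IsPrivatelyBounded P g g') :
    ∫⁻ ω, g (stateAfter P D A i ω) ∂(Measure.pi fun _ => noiseLaw P) ≤
      ENNReal.ofReal (Real.exp (P.lossBudget 0 0)) *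
        ∫⁻ ω, g' (stateAfter P D' A i ω) ∂(Measure.pi fun _ => noiseLaw P) +
      ENNReal.ofReal (Real.exp (P.tailExponent 0 0)) := by
  have := hP.isProbabilityMeasure_noiseLaw
  induction i with
  | zero =>
    have := h ⟨Finset.univ, 0, Fin.elim0⟩ 0 (by
      rw [Nat.cast_zero]; linarith [hP.one_le_hardLimit])
    simpa [stateAfter] using this
  | succ i ih =>
    rw [lintegral_stateAfter_succ hP D A hg, lintegral_stateAfter_succ hP D' A hg']
    exact ih (measurable_expectStep hP D A hg) (measurable_expectStep hP D' A hg')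
      (h.expectStep hP hD A hg hg')

theorem isDifferentiallyPrivate_run {P : Params} (hP : P.Valid) :
    IsDifferentiallyPrivate (randomness P) (run (X := X) P) P.α
      (Real.exp (-(Real.log P.k * Real.log P.N))) := by
  intro A D D' hD S hS
  have hg : Measurable fun s : State X P.m P.k => S.indicator (1 : (Fin P.k → Message) → ENNReal) s.messages :=
    (measurable_one.indicator hS).comp State.measurable_messages
  have hb : IsPrivatelyBounded P
      (fun s : State X P.m P.k => S.indicator (1 : (Fin P.k → Message) → ENNReal) s.messages)
      fun s => S.indicator (1 : (Fin P.k → Message) → ENNReal) s.messages :=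
    isPrivatelyBounded_self hP fun s => Set.indicator_le_self' (fun _ _ => zero_le) _
  have h := hb.lintegral_stateAfter_le hP hD A hg hg
  have hrun : ∀ E : Database X P.n, randomness P {ω | run P E A ω ∈ S} =
      ∫⁻ ω, S.indicator (1 : (Fin P.k → Message) → ENNReal) (stateAfter P E A P.k ω).messages
        ∂(Measure.pi fun _ => noiseLaw P) := by
    intro E
    have hm : MeasurableSet {ω | run P E A ω ∈ S} :=
      (State.measurable_messages.comp (measurable_stateAfter P E A P.k)) hS
    rw [randomness, ← lintegral_indicator_one hm]
    rfl
  rw [hrun, hrun]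
  refine h.trans ?_
  have ht : P.tailExponent 0 0 = -(Real.log P.k * Real.log P.N) := by
    unfold Params.tailExponent; ring
  rw [ht]
  gcongr
  exact hP.lossBudget_zero_le

end

end MedianMechanism

end

namespace MedianMechanism

/-! ### Order of magnitude of the parameters -/

namespace Params.Valid

variable {P : Params} (hP : P.Valid)
include hP

/-- The rounded quantity is at least 1, so rounding up at most doubles it. -/
theorem m_le : P.m ≤ 320000 * Real.log P.k * Real.log (1 / P.ε) / P.ε ^ 2 := by
  have hk := hP.log_k_pos
  have hi := hP.log_inv_ε_pos
  have hε := hP.ε_pos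
  have h1 : (P.m : ℝ) ≤ 160000 * Real.log P.k * Real.log (1 / P.ε) / P.ε ^ 2 + 1 :=
    (Nat.ceil_lt_add_one (by positivity)).le
  have h2 : 1 ≤ 160000 * Real.log P.k * Real.log (1 / P.ε) / P.ε ^ 2 := by
    rw [le_div_iff₀ (by positivity)]
    nlinarith [hP.ε_le, Real.log_two_gt_d9, hP.log_two_le_log_k, hP.log_two_le_log_inv_ε,
      mul_le_mul hP.log_two_le_log_k hP.log_two_le_log_inv_ε (Real.log_pos one_lt_two).le hk.le]
  calc (P.m : ℝ) ≤ _ := h1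
    _ ≤ 2 * (160000 * Real.log P.k * Real.log (1 / P.ε) / P.ε ^ 2) := by linarith
    _ = _ := by ring

theorem le_α' : 1 / 230400000 *
    (P.α * P.ε ^ 2 / (Real.log P.N * Real.log P.k * Real.log (1 / P.ε))) ≤ P.α' := by
  have hN := hP.log_N_pos
  have hk := hP.log_k_pos
  have hi := hP.log_inv_ε_pos
  have hε := hP.ε_pos
  have hα := hP.α_pos
  have hm := hP.m_pos
  have h := hP.m_le
  calc _ = P.α / (720 * (320000 * Real.log P.k * Real.log (1 / P.ε) / P.ε ^ 2) *
        Real.log P.N) := by field_simp; norm_num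
    _ ≤ P.α' := by unfold Params.α'; gcongr

theorem α'_le_mul : P.α' ≤ 1 / 115200000 *
    (P.α * P.ε ^ 2 / (Real.log P.N * Real.log P.k * Real.log (1 / P.ε))) := by
  have hN := hP.log_N_pos
  have hk := hP.log_k_pos
  have hi := hP.log_inv_ε_pos
  have hε := hP.ε_pos
  have hα := hP.α_pos
  have h := P.le_m
  calc P.α' ≤ P.α / (720 * (160000 * Real.log P.k * Real.log (1 / P.ε) / P.ε ^ 2) *
        Real.log P.N) := by unfold Params.α'; gcongr
    _ = _ := by field_simp; norm_num

theorem log_k_le_log_two_mul_k_div_α : Real.log P.k ≤ Real.log (2 * P.k / P.α) := by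
  have hk := hP.two_le_k_real
  refine Real.log_le_log (by linarith) ?_
  rw [le_div_iff₀ hP.α_pos]
  nlinarith [hP.α_le]

theorem log_two_mul_k_div_α_le {b : ℕ} (hb : 1 / (P.k : ℝ) ^ b ≤ P.α) :
    Real.log (2 * P.k / P.α) ≤ (b + 2) * Real.log P.k := by
  have hk := hP.two_le_k_real
  have hk0 : (0 : ℝ) < P.k := by linarith
  have h1 : -(b * Real.log P.k) ≤ Real.log P.α := by
    have := Real.log_le_log (by positivity) hb
    rwa [one_div, Real.log_inv, Real.log_pow] at this
  rw [Real.log_div (by positivity) hP.α_pos.ne', Real.log_mul two_ne_zero hk0.ne']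
  linarith [hP.log_two_le_log_k]

theorem le_n₀ : 30 * 115200000 / Real.log 2 *
    (Real.log P.N * Real.log P.k ^ 3 * Real.log (1 / P.ε) / (P.α * P.ε ^ 3)) ≤ P.n₀ := by
  have hN := hP.log_N_pos
  have hk := hP.log_k_pos
  have hi := hP.log_inv_ε_pos
  have hε := hP.ε_pos
  have hα := hP.α_pos
  have hα' := hP.α'_pos
  have h2 : 0 < Real.log 2 := Real.log_pos one_lt_two
  have h := hP.α'_le_mul
  have hl := hP.log_k_le_log_two_mul_k_div_α
  have hl0 := hk.trans_le hl
  calc _ = 30 * Real.log P.k * (Real.log P.k / Real.log 2) / (1 / 115200000 *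
        (P.α * P.ε ^ 2 / (Real.log P.N * Real.log P.k * Real.log (1 / P.ε))) * P.ε) := by
          field_simp
    _ ≤ P.n₀ := by unfold Params.n₀ Real.logb; gcongr

theorem n₀_le {b : ℕ} (hb : 1 / (P.k : ℝ) ^ b ≤ P.α) : P.n₀ ≤
    30 * (b + 2) * 230400000 / Real.log 2 *
      (Real.log P.N * Real.log P.k ^ 3 * Real.log (1 / P.ε) / (P.α * P.ε ^ 3)) := by
  have hN := hP.log_N_pos
  have hk := hP.log_k_pos
  have hi := hP.log_inv_ε_pos
  have hε := hP.ε_pos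
  have hα := hP.α_pos
  have h2 : 0 < Real.log 2 := Real.log_pos one_lt_two
  have h := hP.le_α'
  have hl := hP.log_two_mul_k_div_α_le hb
  calc P.n₀ ≤ 30 * ((b + 2) * Real.log P.k) * (Real.log P.k / Real.log 2) / (1 / 230400000 *
        (P.α * P.ε ^ 2 / (Real.log P.N * Real.log P.k * Real.log (1 / P.ε))) * P.ε) := by
          unfold Params.n₀ Real.logb; gcongr
    _ = _ := by field_simp

theorem log_sq_le_of_n₀_le (hn : P.n₀ ≤ P.n) :
    30 * Real.log P.k ^ 2 ≤ P.ε * P.n * P.α' := by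
  have hk := hP.log_k_pos
  have hε := hP.ε_pos
  have hα' := hP.α'_pos
  have h2 : 0 < Real.log 2 := Real.log_pos one_lt_two
  have hl := hP.log_k_le_log_two_mul_k_div_α
  have hl0 := hk.trans_le hl
  unfold Params.n₀ at hn
  rw [div_le_iff₀ (by positivity)] at hn
  have h1 : Real.log P.k ≤ Real.logb 2 P.k := by
    rw [Real.logb, le_div_iff₀ h2]
    nlinarith [Real.log_two_lt_d9]
  calc 30 * Real.log P.k ^ 2 = 30 * Real.log P.k * Real.log P.k := by ring
    _ ≤ 30 * Real.log (2 * P.k / P.α) * Real.logb 2 P.k := by gcongr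
    _ ≤ _ := by linarith

/-- The size of the database is at most polynomial in `k` and `ε n α'`. -/
theorem n_le_mul_pow {b : ℕ} (hα : 1 / (P.k : ℝ) ^ b ≤ P.α) (hε : 1 / (P.k : ℝ) ^ b ≤ P.ε)
    (hN : Real.log P.N ≤ (P.k : ℝ) ^ b) :
    P.n ≤ 230400000 * (P.k : ℝ) ^ (6 * b + 1) * (P.ε * P.n * P.α') := by
  have hN0 := hP.log_N_pos
  have hk0 := hP.log_k_pos
  have hi0 := hP.log_inv_ε_pos
  have hε0 := hP.ε_pos
  have hα0 := hP.α_pos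
  have hn0 := hP.n_pos
  have hkpos : (0 : ℝ) < P.k := by linarith [hP.two_le_k_real]
  have hk : Real.log P.k ≤ P.k := (Real.log_le_sub_one_of_pos hkpos).trans (by linarith)
  have hi : Real.log (1 / P.ε) ≤ (P.k : ℝ) ^ b := by
    refine (Real.log_le_sub_one_of_pos (by positivity)).trans ?_
    have : 1 / P.ε ≤ (P.k : ℝ) ^ b := by
      rw [div_le_iff₀ hε0]
      rwa [div_le_iff₀' (by positivity)] at hε
    linarith
  -- In `εα'` the factors `α` and `ε³` cost `4b` powers of `k`, `ln N` and `ln(1/ε)` cost `2b`, and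
  -- `ln k` costs one.
  have h : 1 ≤ 230400000 * (P.k : ℝ) ^ (6 * b + 1) * (P.ε * P.α') := by
    calc (1 : ℝ) = 230400000 * (P.k : ℝ) ^ (6 * b + 1) * (1 / (P.k : ℝ) ^ b *
          (1 / 230400000 * (1 / (P.k : ℝ) ^ b * (1 / (P.k : ℝ) ^ b) ^ 2 /
            ((P.k : ℝ) ^ b * P.k * (P.k : ℝ) ^ b)))) := by
            field_simp
            ring
      _ ≤ 230400000 * (P.k : ℝ) ^ (6 * b + 1) * (P.ε * (1 / 230400000 *
          (P.α * P.ε ^ 2 / (Real.log P.N * Real.log P.k * Real.log (1 / P.ε))))) := by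
            gcongr
      _ ≤ _ := by gcongr; exact hP.le_α'
  calc (P.n : ℝ) = 1 * P.n := (one_mul _).symm
    _ ≤ 230400000 * (P.k : ℝ) ^ (6 * b + 1) * (P.ε * P.α') * P.n := by gcongr
    _ = _ := by ring

theorem failure_le_inverse_pow (p : ℕ) {b : ℕ} (hn : P.n₀ ≤ P.n)
    (hα : 1 / (P.k : ℝ) ^ b ≤ P.α) (hε : 1 / (P.k : ℝ) ^ b ≤ P.ε)
    (hN : Real.log P.N ≤ (P.k : ℝ) ^ b) :
    P.k * Real.exp (-(1 / 400 * (P.ε * P.n * P.α'))) ≤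
      (230400000 ^ p * 800 ^ p * p.factorial *
        Real.exp (20 / 3 * ((1 + p * (6 * b + 2) : ℕ) : ℝ) ^ 2)) / ((P.k : ℝ) * P.n) ^ p := by
  have hkpos : (0 : ℝ) < P.k := by linarith [hP.two_le_k_real]
  have hnpos := hP.n_pos
  have hx0 : 0 < P.ε * P.n * P.α' := mul_pos (mul_pos hP.ε_pos hnpos) hP.α'_pos
  have hsq := hP.log_sq_le_of_n₀_le hn
  have hpoly := hP.n_le_mul_pow hα hε hN
  set x := P.ε * P.n * P.α'
  set M := 1 + p * (6 * b + 2)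
  -- The exponential is split into two equal factors: one absorbs the power of `x` that comes from
  -- bounding `n`, the other all powers of `k`.
  have h1 : x ^ p * Real.exp (-(x / 800)) ≤ 800 ^ p * p.factorial := by
    have := Real.pow_div_factorial_le_exp (x / 800) (by positivity) p
    rw [Real.exp_neg, ← div_eq_mul_inv, div_le_iff₀ (Real.exp_pos _)]
    rw [div_le_iff₀ (by positivity), div_pow, div_le_iff₀ (by positivity)] at this
    linarith
  have h2 : (P.k : ℝ) ^ M * Real.exp (-(x / 800)) ≤ Real.exp (20 / 3 * (M : ℝ) ^ 2) := by
    rw [← Real.exp_log hkpos, ← Real.exp_nat_mul, ← Real.exp_add, Real.exp_le_exp]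
    -- As `x ≥ 30 ln² k`, the exponent is at most `Mu - 3u²/80` with `u = ln k`, whose maximum
    -- `20M²/3` is attained at `u = 40M/3`.
    nlinarith [sq_nonneg (Real.log P.k - 40 / 3 * M)]
  have h3 : Real.exp (-(1 / 400 * x)) = Real.exp (-(x / 800)) * Real.exp (-(x / 800)) := by
    rw [← Real.exp_add]; congr 1; ring
  rw [le_div_iff₀ (by positivity), h3]
  calc P.k * (Real.exp (-(x / 800)) * Real.exp (-(x / 800))) * (P.k * P.n) ^ p
      ≤ P.k * (Real.exp (-(x / 800)) * Real.exp (-(x / 800))) *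
        (P.k * (230400000 * (P.k : ℝ) ^ (6 * b + 1) * x)) ^ p := by gcongr
    _ = 230400000 ^ p * (x ^ p * Real.exp (-(x / 800))) *
        ((P.k : ℝ) ^ M * Real.exp (-(x / 800))) := by
          have : (P.k : ℝ) ^ M = P.k * (P.k ^ p * (P.k ^ (6 * b + 1)) ^ p) := by
            rw [← pow_mul, ← pow_add, ← pow_succ']
            congr 1
            simp only [M]
            ring
          rw [this]
          simp only [mul_pow]
          ring
    _ ≤ 230400000 ^ p * (800 ^ p * p.factorial) * Real.exp (20 / 3 * (M : ℝ) ^ 2) := by gcongr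
    _ = _ := by ring

end Params.Valid

theorem isNegligible_exp_neg_log_mul_log :
    IsNegligible fun k N => Real.exp (-(Real.log k * Real.log N)) := by
  intro c
  have hlog : Tendsto (fun n : ℕ => Real.log n) atTop atTop :=
    Real.tendsto_log_atTop.comp tendsto_natCast_atTop_atTop
  have h0 : Tendsto (fun z : ℕ × ℕ => ((z.1 : ℝ))⁻¹) (atTop ×ˢ atTop) (𝓝 0) :=
    (tendsto_inv_atTop_zero.comp tendsto_natCast_atTop_atTop).comp tendsto_fst
  refine squeeze_zero' (Eventually.of_forall fun z => by positivity) ?_ h0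
  -- If `u = ln k` and `v = ln N` are both at least `2c + 2`, then `uv ≥ (c + 1)(u + v)`, so `c(u +
  -- v) - uv ≤ -u` and the expression is at most `1/k`.
  filter_upwards [tendsto_fst.eventually (hlog.eventually_ge_atTop (2 * c + 2 : ℝ)),
    tendsto_snd.eventually (hlog.eventually_ge_atTop (2 * c + 2 : ℝ)),
    tendsto_fst.eventually (eventually_ge_atTop 1),
    tendsto_snd.eventually (eventually_ge_atTop 1)] with z hu hv hk hN
  have hk' : (0 : ℝ) < z.1 := by exact_mod_cast hk
  have hN' : (0 : ℝ) < z.2 := by exact_mod_cast hN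
  have hc : (0 : ℝ) ≤ c := Nat.cast_nonneg _
  rw [abs_of_pos (Real.exp_pos _)]
  nth_rw 1 [← Real.exp_log hk', ← Real.exp_log hN']
  rw [← Real.exp_add, ← Real.exp_nat_mul, ← Real.exp_add, ← Real.exp_log (inv_pos.2 hk'),
    Real.log_inv]
  refine Real.exp_le_exp.2 ?_
  nlinarith

end MedianMechanism

/-! ### The theorem, assembled from utility, privacy and the size of the parameters. -/

theorem theorem1 :
    (∃ c : ℝ, 0 < c ∧
      (∀ (P : MedianMechanism.Params) (X : Type*) [Fintype X] [DecidableEq X],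
        P.Valid → Fintype.card X = P.N →
        MedianMechanism.IsUseful (MedianMechanism.randomness P)
          (MedianMechanism.run (X := X) P)
          P.ε (P.k * Real.exp (-(c * (P.ε * P.n * P.α'))))) ∧
      (∀ p b : ℕ, ∃ B : ℝ, ∀ P : MedianMechanism.Params, P.Valid → P.n₀ ≤ P.n →
        1 / (P.k : ℝ) ^ b ≤ P.α → 1 / (P.k : ℝ) ^ b ≤ P.ε →
        Real.log P.N ≤ (P.k : ℝ) ^ b →
        P.k * Real.exp (-(c * (P.ε * P.n * P.α'))) ≤ B / ((P.k : ℝ) * P.n) ^ p)) ∧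
    (∃ τ : ℕ → ℕ → ℝ, MedianMechanism.IsNegligible τ ∧
      ∀ (P : MedianMechanism.Params) (X : Type*) [Fintype X] [DecidableEq X],
        P.Valid → Fintype.card X = P.N → P.n₀ ≤ P.n →
        MedianMechanism.IsDifferentiallyPrivate (MedianMechanism.randomness P)
          (MedianMechanism.run (X := X) P) P.α (τ P.k P.N)) ∧
    (∃ c₁ c₂ : ℝ, 0 < c₁ ∧ 0 < c₂ ∧ ∀ P : MedianMechanism.Params, P.Valid →
      c₁ * (P.α * P.ε ^ 2 / (Real.log P.N * Real.log P.k * Real.log (1 / P.ε))) ≤ P.α' ∧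
      P.α' ≤ c₂ * (P.α * P.ε ^ 2 / (Real.log P.N * Real.log P.k * Real.log (1 / P.ε)))) ∧
    (∀ b : ℕ, ∃ c₁ c₂ : ℝ, 0 < c₁ ∧ 0 < c₂ ∧ ∀ P : MedianMechanism.Params, P.Valid →
      1 / (P.k : ℝ) ^ b ≤ P.α →
      c₁ * (Real.log P.N * Real.log P.k ^ 3 * Real.log (1 / P.ε) / (P.α * P.ε ^ 3)) ≤ P.n₀ ∧
      P.n₀ ≤ c₂ * (Real.log P.N * Real.log P.k ^ 3 * Real.log (1 / P.ε) / (P.α * P.ε ^ 3))) := by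
  have h2 : 0 < Real.log 2 := Real.log_pos one_lt_two
  refine ⟨⟨1 / 400, by norm_num, ?_, ?_⟩, ⟨_, MedianMechanism.isNegligible_exp_neg_log_mul_log, ?_⟩,
    ⟨1 / 230400000, 1 / 115200000, by norm_num, by norm_num, fun P hP => ⟨hP.le_α', hP.α'_le_mul⟩⟩,
    fun b => ⟨30 * 115200000 / Real.log 2, 30 * (b + 2) * 230400000 / Real.log 2, by positivity,
      by positivity, fun P hP hb => ⟨hP.le_n₀, hP.n₀_le hb⟩⟩⟩
  · intro P X _ _ hP hX
    exact MedianMechanism.isUseful_run hP hX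
  · intro p b
    exact ⟨_, fun P hP hn hα hε hN => hP.failure_le_inverse_pow p hn hα hε hN⟩
  · intro P X _ _ hP _ _
    exact MedianMechanism.isDifferentiallyPrivate_run hP
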